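/- Let $C_i$ be the non-singular model of the plane curve $u^4=t^2(t-1)$ over $\mathbb C$. It has one point $P_1$ over $t=1$, one point $P_\infty$ over $t=\infty$, and over $t=0$ two points, distinguished by the value $\pm i$ of the regular function $w=u^2/t$ (which satisfies $w^2=t-1$). Let $E_i=\mathbb C/L_i$ with $L_i=\mathbb Z i+\mathbb Z$, and let $$\varphi_1=\frac{1}{(1-i)B(\frac14,\frac14)}\cdot\frac{u\,dt}{t(t-1)},\qquad \jmath_i:C_i\to E_i,\quad P\mapsto \int_{P_1}^{P}\varphi_1 \bmod L_i ,$$ be the normalized holomorphic $1$-form and the Abel-Jacobi map, where $B$ is the beta function. Then $\jmath_i$ is well defined (every $P\in C_i$ is the end point of a path of integration from $P_1$, and modulo $L_i$ the integral does not depend on the path) and bijective, and multiplication by $1+i$ on $E_i$ is given as follows. If $z=\jmath_i(t,u)$ for a point $(t,u)$ of $C_i$ with $t\ne 0,\infty$, then $$\jmath_i^{-1}((1+i)z)=\left(\left(\frac{t-2}{t}\right)^2,\ (1+i)\frac{u(2-t)}{t^2}\right),$$ where this point of $C_i$ has $w$-coordinate $2iu^2/t^2$ (so that, for $t=2$, it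 is the point over $t=0$ with $w=i$ if $u^2=2$, and the one with $w=-i$ if $u^2=-2$). If $z=\jmath_i(P)$ for one of the two points $P$ over $t=0$, then $\jmath_i^{-1}((1+i)z)=P_\infty$; if $z=\jmath_i(P_\infty)$, then $\jmath_i^{-1}((1+i)z)=P_1$. -/

import Mathlib

namespace QuarticCurve

open Complex

/-- The affine part of the non-singular model of the curve `u ^ 4 = t ^ 2 * (t - 1)`, as a subset
of `ℂ³` with coordinates `(t, u, w)`.  The node `(t, u) = (0, 0)` of the plane curve is resolved
by adjoining the integral element `w = u ^ 2 / t`, which satisfies `w ^ 2 = t - 1`.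
Over a point `(t, u)` with `t ≠ 0` there is exactly one point `(t, u, u ^ 2 / t)`; over the node
there are the two points `(0, 0, i)` and `(0, 0, -i)`.  The curve is smooth, since `(u, w)` maps it
isomorphically onto `u ^ 2 = w ^ 3 + w`. -/
def affineCurve : Set (ℂ × ℂ × ℂ) :=
  {p | p.2.1 ^ 4 = p.1 ^ 2 * (p.1 - 1) ∧ p.1 * p.2.2 = p.2.1 ^ 2 ∧ p.2.2 ^ 2 = p.1 - 1}

/-- The coordinate `t` of an affine point. -/
def tA (P : affineCurve) : ℂ := P.1.1

/-- The coordinate `u` of an affine point. -/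
def uA (P : affineCurve) : ℂ := P.1.2.1

/-- The coordinate `w = u ^ 2 / t` of an affine point. -/
def wA (P : affineCurve) : ℂ := P.1.2.2

/-- The non-singular model of `u ^ 4 = t ^ 2 * (t - 1)` with its classical topology.  There is
exactly one point over `t = ∞`, namely `[s₀, s₁, s₂] = [0, 1, 0]`, so that the compact curve is
the one-point compactification of its affine part. -/
abbrev Curve : Type := OnePoint affineCurve

/-- The point of the curve over `t = ∞`. -/
def pointInfty : Curve := OnePoint.infty

/-- The point `(t, u) = (1, 0)`. -/
def pointOne : Curve :=
  ((⟨(1, 0, 0), by simp [affineCurve]⟩ : affineCurve) : OnePoint affineCurve)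

/-- The function `t` on the curve (which has a pole at `∞`; the value `0` there is never used). -/
noncomputable def t (P : Curve) : ℂ := P.elim 0 tA

/-- The function `u` on the curve (which has a pole at `∞`; the value `0` there is never used). -/
noncomputable def u (P : Curve) : ℂ := P.elim 0 uA

/-- The integrand of `∫_γ φ`, `φ = u dt / (t (t - 1))`, in the parameter of the path. -/
noncomputable def integrand {P Q : Curve} (γ : Path P Q) (s : ℝ) : ℂ :=
  u (γ.extend s) * deriv (fun r : ℝ => t (γ.extend r)) s /
    (t (γ.extend s) * (t (γ.extend s) - 1))

/-- The paths of integration: continuous paths on the compact curve which, off finitely many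
parameter values, are continuously differentiable and avoid the points over `t = 0, 1, ∞`, and
along which the (possibly improper) integral of `φ` converges absolutely. -/
def Admissible {P Q : Curve} (γ : Path P Q) : Prop :=
  (∃ S : Set ℝ, S.Finite ∧ ∀ s ∈ Set.Ioo (0 : ℝ) 1 \ S,
    γ.extend s ≠ pointInfty ∧ t (γ.extend s) ≠ 0 ∧ t (γ.extend s) ≠ 1 ∧
    ContDiffAt ℝ 1 (fun r : ℝ => t (γ.extend r)) s ∧
    ContDiffAt ℝ 1 (fun r : ℝ => u (γ.extend r)) s) ∧
  IntervalIntegrable (integrand γ) MeasureTheory.volume 0 1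

/-- `∫_γ φ₁`, where `φ₁ = φ / ((1 - i) B(1/4, 1/4))` is the normalized holomorphic form. -/
noncomputable def pathIntegral {P Q : Curve} (γ : Path P Q) : ℂ :=
  (1 / ((1 - I) * betaIntegral (1 / 4) (1 / 4))) * ∫ s in (0 : ℝ)..1, integrand γ s

/-- The lattice `L = ℤ i + ℤ`. -/
def lattice : AddSubgroup ℂ := AddSubgroup.closure {I, 1}

/-- The complex torus `E = ℂ / L`. -/
abbrev Torus : Type := ℂ ⧸ lattice

open Classical in
/-- The Abel-Jacobi map `P ↦ ∫_{P₁}^P φ₁ mod L`, computed along some admissible path.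
(Existence of a path and independence of its choice are not part of the definition.) -/
noncomputable def abelJacobi (P : Curve) : Torus :=
  if h : ∃ γ : Path pointOne P, Admissible γ then
    ((pathIntegral h.choose : ℂ) : Torus)
  else 0

theorem lattice_le_comap :
    lattice ≤ lattice.comap (AddMonoidHom.mulLeft (1 + I)) := by
  have h1 : (1 : ℂ) ∈ lattice := AddSubgroup.subset_closure (by simp)
  have hI : I ∈ lattice := AddSubgroup.subset_closure (by simp)
  refine (AddSubgroup.closure_le _).2 ?_
  rintro x (rfl | rfl)
  · have : (1 + I) * I = I - 1 := by
      have := I_mul_I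
      linear_combination this
    simpa [this] using lattice.sub_mem hI h1
  · simpa using lattice.add_mem h1 hI

/-- Multiplication by `1 + i` on the torus `E`. -/
def mulOneAddI : Torus →+ Torus :=
  QuotientAddGroup.map lattice lattice (AddMonoidHom.mulLeft (1 + I)) lattice_le_comap

end QuarticCurve

/-! The curve is uniformized explicitly by the Weierstrass function of the lattice `ℤ + ℤ i`. That
lattice is stable under multiplication by `i`, so `g₃ = 0`, `℘` vanishes at `om = (1 + i) / 2`, and
`℘' ^ 2 = 4 ℘ (℘ ^ 2 - e ^ 2)` with `e = ℘(1/2) > 0`. After the shift by `om`, suitable multiples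
`W` of `℘` and `U` of `℘'` satisfy `U ^ 2 = W ^ 3 + W` and vanish at `0`, and `psi z = (W ^ 2 + 1,
U, W)` identifies the torus with the curve.

Write `K` for `normConst`. Since `W' = K U / 2`, the form `u dt / (t (t - 1)) = 2 dw / u` pulls back
to `K dz`, so the normalized form becomes `dz` and the Abel-Jacobi map is the inverse of `psi`
(`abelJacobi_psi`). This requires `K ^ 2 = -16 i e`, that is `B(1/4, 1/4) ^ 2 = 8 e`
(`betaIntegral_quarter_sq`), the only place where the beta function matters.

Path integrals are computed by lifting paths to `ℂ` (`exists_lift`), where the lift is a primitive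
of the integrand (`pathIntegral_eq`). The multiplication formula holds because both of its sides
solve the same differential equation with the same initial value (`eventually_W_mul`); the identity
theorem extends it globally (`W_mul`). -/

open Filter Topology

/-! ### Uniqueness for differential equations and general facts on `℘` -/

/-- Local uniqueness of solutions of an autonomous holomorphic differential equation. -/
theorem Complex.ode_solution_unique {E : Type*} [NormedAddCommGroup E] [NormedSpace ℂ E]
    [CompleteSpace E] {v : E → E} {F G : ℂ → E} {a : ℂ} (hv : ContDiff ℝ 1 v)
    (hF : ∀ᶠ z in 𝓝 a, HasDerivAt F (v (F z)) z) (hG : ∀ᶠ z in 𝓝 a, HasDerivAt G (v (G z)) z)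
    (h : F a = G a) : F =ᶠ[𝓝 a] G := by
  have hFa : AnalyticAt ℂ F a := Complex.analyticAt_iff_eventually_differentiableAt.2
    (hF.mono fun z hz ↦ hz.differentiableAt)
  have hGa : AnalyticAt ℂ G a := Complex.analyticAt_iff_eventually_differentiableAt.2
    (hG.mono fun z hz ↦ hz.differentiableAt)
  have hcont : Tendsto (fun r : ℝ ↦ a + (r : ℂ)) (𝓝 0) (𝓝 a) := by
    have : Continuous fun r : ℝ ↦ a + (r : ℂ) := by fun_prop
    simpa using this.tendsto 0
  obtain ⟨K, s, hs, hK⟩ := (hv.contDiffAt (x := F a)).exists_lipschitzOnWith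
  have key : ∀ H : ℂ → E, (∀ᶠ z in 𝓝 a, HasDerivAt H (v (H z)) z) → H a = F a →
      ∀ᶠ r : ℝ in 𝓝 0, HasDerivAt (fun r : ℝ ↦ H (a + r)) (v (H (a + r))) r ∧ H (a + r) ∈ s := by
    intro H hH hHa
    have hc : ContinuousAt H a := hH.self_of_nhds.continuousAt
    filter_upwards [hcont.eventually hH, hcont.eventually (hc.eventually_mem (hHa ▸ hs))]
      with r hr hr'
    refine ⟨?_, hr'⟩
    have h1 : HasDerivAt (fun r : ℝ ↦ a + (r : ℂ)) 1 r := Complex.ofRealCLM.hasDerivAt.const_add a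
    simpa [Function.comp_def] using hr.scomp r h1
  -- Real uniqueness applies along the horizontal line through `a`; the identity theorem then passes
  -- from that line to a full neighbourhood.
  have hreal := ODE_solution_unique_of_eventually (v := fun _ ↦ v) (s := fun _ ↦ s) (t₀ := (0 : ℝ))
    (f := fun r : ℝ ↦ F (a + r)) (g := fun r : ℝ ↦ G (a + r)) (K := K)
    (.of_forall fun _ ↦ hK) (key F hF rfl) (key G hG h.symm) (by simpa using h)
  refine (hFa.frequently_eq_iff_eventually_eq hGa).1 ?_
  have hne : Tendsto (fun r : ℝ ↦ a + (r : ℂ)) (𝓝[≠] 0) (𝓝[≠] a) := by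
    refine tendsto_nhdsWithin_iff.2 ⟨hcont.mono_left nhdsWithin_le_nhds, ?_⟩
    filter_upwards [self_mem_nhdsWithin] with r hr
    simpa using hr
  exact hne.frequently (Eventually.frequently (hreal.filter_mono nhdsWithin_le_nhds))

/-- This supplies the connected domains on which the identity theorem is applied, once countably
many poles are removed. -/
theorem isPreconnected_compl_of_countable {s : Set ℂ} (hs : s.Countable) : IsPreconnected sᶜ :=
  (hs.isPathConnected_compl_of_one_lt_rank (by simp)).isConnected.isPreconnected

namespace PeriodPair

variable (L : PeriodPair)

theorem countable_lattice : (L.lattice : Set ℂ).Countable := by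
  have : Countable L.lattice := L.latticeEquivProd.toEquiv.countable_iff.2 inferInstance
  exact this

theorem isPreconnected_compl_lattice : IsPreconnected (L.lattice : Set ℂ)ᶜ :=
  isPreconnected_compl_of_countable L.countable_lattice

theorem compl_lattice_mem_nhds {z : ℂ} (hz : z ∉ L.lattice) : (L.lattice : Set ℂ)ᶜ ∈ 𝓝 z :=
  L.isClosed_lattice.isOpen_compl.mem_nhds hz

theorem hasDerivAt_weierstrassP {z : ℂ} (hz : z ∉ L.lattice) :
    HasDerivAt L.weierstrassP (L.derivWeierstrassP z) z := by
  rw [← L.deriv_weierstrassP]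
  exact (L.analyticOnNhd_weierstrassP z hz).differentiableAt.hasDerivAt

theorem tendsto_weierstrassP_cobounded {l : ℂ} (hl : l ∈ L.lattice) :
    Tendsto L.weierstrassP (𝓝[≠] l) (Bornology.cobounded ℂ) :=
  tendsto_cobounded_of_meromorphicOrderAt_neg (by rw [L.order_weierstrassP l hl]; decide)

theorem eventually_notMem_lattice (z : ℂ) : ∀ᶠ x in 𝓝[≠] z, x ∉ L.lattice := by
  filter_upwards [self_mem_nhdsWithin,
    mem_nhdsWithin_of_mem_nhds (L.compl_lattice_sdiff_singleton_mem_nhds z)] with x hx hx' h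
  exact hx' ⟨h, hx⟩

/-- Otherwise `℘` would be constant off the lattice, contradicting its pole at `0`. -/
theorem exists_derivWeierstrassP_ne_zero : ∃ z ∉ L.lattice, L.derivWeierstrassP z ≠ 0 := by
  by_contra! h
  have hz := L.ω₁_div_two_notMem_lattice
  have hc : ∀ x ∉ L.lattice, L.weierstrassP x = L.weierstrassP (L.ω₁ / 2) := fun x hx ↦
    L.isClosed_lattice.isOpen_compl.is_const_of_deriv_eq_zero L.isPreconnected_compl_lattice
      L.differentiableOn_weierstrassP (fun x hx ↦ by simpa using h x hx) hx hz
  have h1 := L.tendsto_weierstrassP_cobounded (l := 0) (zero_mem _)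
  have h2 : Tendsto L.weierstrassP (𝓝[≠] 0) (𝓝 (L.weierstrassP (L.ω₁ / 2))) :=
    tendsto_const_nhds.congr' ((L.eventually_notMem_lattice 0).mono fun x hx ↦ (hc x hx).symm)
  exact h2.not_tendsto (Metric.disjoint_nhds_cobounded _) h1

/-- Differentiating the cubic relation gives the claim multiplied by `℘'`. Since `℘'` is not
identically zero on a connected domain, it can be cancelled. -/
theorem deriv_derivWeierstrassP {z : ℂ} (hz : z ∉ L.lattice) :
    deriv L.derivWeierstrassP z = 6 * L.weierstrassP z ^ 2 - L.g₂ / 2 := by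
  have hP := L.analyticOnNhd_weierstrassP
  have hP' := L.analyticOnNhd_derivWeierstrassP
  have hmul : ∀ w ∈ (L.lattice : Set ℂ)ᶜ, L.derivWeierstrassP w *
      (deriv L.derivWeierstrassP w - (6 * L.weierstrassP w ^ 2 - L.g₂ / 2)) = 0 := by
    intro w hw
    have h1 := L.hasDerivAt_weierstrassP hw
    have h2 := (hP' w hw).differentiableAt.hasDerivAt
    have h3 := h2.pow 2
    have h4 := (((h1.pow 3).const_mul 4).sub (h1.const_mul L.g₂)).sub_const L.g₃
    have h5 := h3.congr_of_eventuallyEq (f₁ := fun z ↦ 4 * L.weierstrassP z ^ 3 -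
        L.g₂ * L.weierstrassP z - L.g₃) (by
      filter_upwards [L.compl_lattice_mem_nhds hw] with x hx
      exact (L.derivWeierstrassP_sq x hx).symm)
    have h6 := h4.unique h5
    simp only [Nat.cast_ofNat] at h6
    linear_combination -h6 / 2
  rcases AnalyticOnNhd.eq_zero_or_eq_zero_of_mul_eq_zero (U := (L.lattice : Set ℂ)ᶜ)
    (f := L.derivWeierstrassP)
    (g := fun z ↦ deriv L.derivWeierstrassP z - (6 * L.weierstrassP z ^ 2 - L.g₂ / 2)) hP'
    (fun z hz ↦ by
      have := hP z hz
      have := (hP' z hz).deriv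
      fun_prop) hmul L.isPreconnected_compl_lattice with h | h
  · obtain ⟨w, hw, hw'⟩ := L.exists_derivWeierstrassP_ne_zero
    exact (hw' (h w hw)).elim
  · exact sub_eq_zero.1 (h z hz)

theorem hasDerivAt_derivWeierstrassP {z : ℂ} (hz : z ∉ L.lattice) :
    HasDerivAt L.derivWeierstrassP (6 * L.weierstrassP z ^ 2 - L.g₂ / 2) z := by
  rw [← L.deriv_derivWeierstrassP hz]
  exact (L.analyticOnNhd_derivWeierstrassP z hz).differentiableAt.hasDerivAt

/-- The pair `(℘, ℘')` separates points modulo the lattice. -/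
theorem sub_mem_lattice {a b : ℂ} (ha : a ∉ L.lattice) (hb : b ∉ L.lattice)
    (h : L.weierstrassP a = L.weierstrassP b)
    (h' : L.derivWeierstrassP a = L.derivWeierstrassP b) : a - b ∈ L.lattice := by
  by_contra hab
  set c := a - b with hc
  -- Both `(℘, ℘')` and its translate by `c` solve `(p, q)' = (q, 6 p ^ 2 - g₂ / 2)` with equal
  -- values at `b`. Then `℘` is `c`-periodic, so its pole at `0` forces a pole at `c`.
  have hloc : L.weierstrassP =ᶠ[𝓝 b] fun z ↦ L.weierstrassP (z + c) := by
    have hs : Tendsto (fun z ↦ z + c) (𝓝 b) (𝓝 a) := by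
      have : Continuous fun z : ℂ ↦ z + c := by fun_prop
      simpa [hc] using this.tendsto b
    have := Complex.ode_solution_unique (a := b)
      (v := fun p : ℂ × ℂ ↦ (p.2, 6 * p.1 ^ 2 - L.g₂ / 2))
      (F := fun z ↦ (L.weierstrassP z, L.derivWeierstrassP z))
      (G := fun z ↦ (L.weierstrassP (z + c), L.derivWeierstrassP (z + c)))
      (by fun_prop)
      (by
        filter_upwards [L.compl_lattice_mem_nhds hb] with z hz
        exact (L.hasDerivAt_weierstrassP hz).prodMk (L.hasDerivAt_derivWeierstrassP hz))
      (by
        filter_upwards [hs.eventually_mem (L.compl_lattice_mem_nhds ha)] with z hz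
        exact ((L.hasDerivAt_weierstrassP hz).comp_add_const z c).prodMk
          ((L.hasDerivAt_derivWeierstrassP hz).comp_add_const z c))
      (by simp [hc, h, h'])
    exact this.mono fun z hz ↦ congrArg Prod.fst hz
  have hcount : ((L.lattice : Set ℂ) ∪ (fun z ↦ z + c) ⁻¹' L.lattice).Countable :=
    L.countable_lattice.union (L.countable_lattice.preimage (add_left_injective c))
  have hpre := isPreconnected_compl_of_countable hcount
  have heq := AnalyticOnNhd.eqOn_of_preconnected_of_eventuallyEq
    (U := ((L.lattice : Set ℂ) ∪ (fun z ↦ z + c) ⁻¹' L.lattice)ᶜ)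
    (f := L.weierstrassP) (g := fun z ↦ L.weierstrassP (z + c))
    (fun z hz ↦ L.analyticOnNhd_weierstrassP z fun h ↦ hz (.inl h))
    (fun z hz ↦ (L.analyticOnNhd_weierstrassP (z + c) fun h ↦ hz (.inr h)).comp
      (f := fun z ↦ z + c) (by fun_prop)) hpre
    (z₀ := b) (by simp [hb, hc, ha]) hloc
  have h1 := L.tendsto_weierstrassP_cobounded (l := 0) (zero_mem _)
  have hcc : Continuous fun z : ℂ ↦ z + c := by fun_prop
  have h0 : Tendsto (fun z ↦ z + c) (𝓝 0) (𝓝 c) := by simpa using hcc.tendsto 0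
  have h2 : Tendsto L.weierstrassP (𝓝[≠] 0) (𝓝 (L.weierstrassP c)) := by
    refine (((L.analyticOnNhd_weierstrassP c hab).continuousAt.tendsto.comp h0).mono_left
      nhdsWithin_le_nhds).congr' ?_
    filter_upwards [L.eventually_notMem_lattice 0, mem_nhdsWithin_of_mem_nhds
      (h0.eventually_mem (L.compl_lattice_mem_nhds hab))] with z hz hz'
    exact (heq (x := z) (by simpa [hz] using hz')).symm
  exact h2.not_tendsto (Metric.disjoint_nhds_cobounded _) h1

/-- The function `℘` takes every value. -/
theorem exists_weierstrassP_eq (w : ℂ) : ∃ z ∉ L.lattice, L.weierstrassP z = w := by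
  classical
  by_contra! hw
  -- If `w` is omitted, `1 / (℘ - w)` extends by `0` over the poles to an entire periodic function,
  -- which Liouville's theorem forces to vanish.
  set g : ℂ → ℂ := fun z ↦ if z ∈ L.lattice then 0 else (L.weierstrassP z - w)⁻¹ with hg
  have hoff : ∀ z ∉ L.lattice, DifferentiableAt ℂ g z := fun z hz ↦ by
    have h1 : DifferentiableAt ℂ (fun z ↦ (L.weierstrassP z - w)⁻¹) z :=
      ((L.hasDerivAt_weierstrassP hz).differentiableAt.sub_const w).inv (sub_ne_zero.2 (hw z hz))
    refine h1.congr_of_eventuallyEq ?_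
    filter_upwards [L.compl_lattice_mem_nhds hz] with x hx
    exact if_neg hx
  have hdiff : Differentiable ℂ g := fun z ↦ by
    by_cases hz : z ∈ L.lattice
    · refine (Complex.analyticAt_of_differentiable_on_punctured_nhds_of_continuousAt
        ((L.eventually_notMem_lattice z).mono fun x hx ↦ hoff x hx) ?_).differentiableAt
      rw [continuousAt_iff_punctured_nhds]
      have h1 : Tendsto (fun x ↦ (L.weierstrassP x - w)⁻¹) (𝓝[≠] z) (𝓝 0) := by
        refine tendsto_inv₀_cobounded.comp ?_
        simpa [sub_eq_add_neg, Function.comp_def] using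
          (tendsto_add_const_cobounded (-w)).comp (L.tendsto_weierstrassP_cobounded hz)
      have h0 : g z = 0 := if_pos hz
      rw [h0]
      exact h1.congr' ((L.eventually_notMem_lattice z).mono fun x hx ↦ (if_neg hx).symm)
    · exact hoff z hz
  have hper : ∀ z, ∀ l ∈ L.lattice, g (z + l) = g z := fun z l hl ↦ by
    have h1 : z + l ∈ L.lattice ↔ z ∈ L.lattice := Submodule.add_mem_iff_left _ hl
    have h2 := L.weierstrassP_add_coe z ⟨l, hl⟩
    simp only [hg, h1, h2]
  have hzero : ∀ z, g z = 0 := fun z ↦ (hdiff.apply_eq_apply_of_bounded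
    (IsZLattice.isCompact_range_of_periodic L.lattice g hdiff.continuous hper).isBounded z 0).trans
      (if_pos (zero_mem _))
  have hz := L.ω₁_div_two_notMem_lattice
  have := hzero (L.ω₁ / 2)
  simp only [hg, if_neg hz, inv_eq_zero, sub_eq_zero] at this
  exact hw _ hz this

end PeriodPair

/-! ### The Gaussian lattice and `℘` on the real segment `(0, 1/2]` -/

namespace QuarticCurve

open Complex ComplexConjugate

/-- The periods `1, i`. -/
noncomputable def gauss : PeriodPair where
  ω₁ := 1
  ω₂ := I
  indep := by
    rw [LinearIndependent.pair_iff]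
    intro s t h
    have h1 := congrArg re h
    have h2 := congrArg im h
    simpa using And.intro h1 h2


theorem mem_gauss {z : ℂ} : z ∈ gauss.lattice ↔ ∃ m n : ℤ, (m : ℂ) + n * I = z := by
  simp [PeriodPair.mem_lattice, gauss]

theorem mem_gauss_iff {z : ℂ} : z ∈ gauss.lattice ↔
    (∃ m : ℤ, (m : ℝ) = z.re) ∧ ∃ n : ℤ, (n : ℝ) = z.im := by
  rw [mem_gauss]
  constructor
  · rintro ⟨m, n, rfl⟩
    simp
  · rintro ⟨⟨m, hm⟩, n, hn⟩
    exact ⟨m, n, by apply Complex.ext <;> simp [hm, hn]⟩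

theorem lattice_eq_gauss : lattice = gauss.lattice.toAddSubgroup := by
  rw [lattice, PeriodPair.lattice, ← Submodule.span_int_eq_addSubgroupClosure, Set.pair_comm]
  rfl

theorem I_mul_mem_gauss {z : ℂ} (hz : z ∈ gauss.lattice) : I * z ∈ gauss.lattice := by
  obtain ⟨m, n, rfl⟩ := mem_gauss.1 hz
  refine mem_gauss.2 ⟨-n, m, ?_⟩
  push_cast
  linear_combination -(n : ℂ) * I_mul_I

theorem conj_mem_gauss {z : ℂ} (hz : z ∈ gauss.lattice) : conj z ∈ gauss.lattice := by
  obtain ⟨m, n, rfl⟩ := mem_gauss.1 hz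
  exact mem_gauss.2 ⟨m, -n, by simp⟩

/-- Multiplication by `i` on the Gaussian integers. -/
noncomputable def mulIEquiv : gauss.lattice ≃ gauss.lattice where
  toFun l := ⟨I * l, I_mul_mem_gauss l.2⟩
  invFun l := ⟨-(I * l), neg_mem (I_mul_mem_gauss l.2)⟩
  left_inv l := Subtype.ext (by
    change -(I * (I * l)) = l
    linear_combination -(l : ℂ) * I_mul_I)
  right_inv l := Subtype.ext (by
    change I * -(I * l) = l
    linear_combination -(l : ℂ) * I_mul_I)

/-- Conjugation on the Gaussian integers. -/
noncomputable def conjEquiv : gauss.lattice ≃ gauss.lattice where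
  toFun l := ⟨conj (l : ℂ), conj_mem_gauss l.2⟩
  invFun l := ⟨conj (l : ℂ), conj_mem_gauss l.2⟩
  left_inv _ := Subtype.ext (conj_conj _)
  right_inv _ := Subtype.ext (conj_conj _)

theorem weierstrassP_I_mul (z : ℂ) : gauss.weierstrassP (I * z) = -gauss.weierstrassP z := by
  simp only [PeriodPair.weierstrassP]
  rw [← mulIEquiv.tsum_eq, ← tsum_neg]
  congr! 2 with l
  change 1 / (I * z - I * l) ^ 2 - 1 / (I * (l : ℂ)) ^ 2 = _
  rw [← mul_sub, mul_pow, mul_pow, I_sq]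
  simp only [neg_mul, one_mul, div_neg]
  ring

/-- Together with its analogue for `℘'`, this makes both functions real on the real axis, where the
beta integral is evaluated. -/
theorem weierstrassP_conj (z : ℂ) : gauss.weierstrassP (conj z) = conj (gauss.weierstrassP z) := by
  simp only [PeriodPair.weierstrassP]
  rw [← conjEquiv.tsum_eq, conj_tsum]
  congr! 2 with l
  change 1 / (conj z - conj (l : ℂ)) ^ 2 - 1 / (conj (l : ℂ)) ^ 2 = _
  simp

theorem derivWeierstrassP_conj (z : ℂ) :
    gauss.derivWeierstrassP (conj z) = conj (gauss.derivWeierstrassP z) := by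
  simp only [PeriodPair.derivWeierstrassP, map_neg]
  rw [← conjEquiv.tsum_eq, conj_tsum]
  congr! 3 with l
  change 2 / (conj z - conj (l : ℂ)) ^ 3 = _
  simp [map_ofNat]

/-- Reindexing the Eisenstein sum by `l ↦ i l` multiplies it by `(i ^ 6)⁻¹ = -1`. -/
theorem gauss_g₃ : PeriodPair.g₃ gauss = 0 := by
  have : PeriodPair.G gauss 6 = 0 := by
    rw [← CharZero.eq_neg_self_iff, PeriodPair.G, ← tsum_neg]
    conv_lhs => rw [← mulIEquiv.tsum_eq]
    congr! 2 with l
    change ((I * (l : ℂ)) ^ 6)⁻¹ = _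
    rw [mul_pow, show I ^ 6 = -1 by rw [show (6 : ℕ) = 2 * 3 by norm_num, pow_mul, I_sq]; norm_num]
    rw [neg_one_mul, inv_neg]
  simp [PeriodPair.g₃, this]

/-- The half period `(1 + i) / 2`. -/
noncomputable def om : ℂ := (1 + I) / 2

theorem om_re : om.re = 1 / 2 := by simp [om]

theorem om_im : om.im = 1 / 2 := by simp [om]

theorem half_ne_int (m : ℤ) : (m : ℝ) ≠ 1 / 2 := by
  intro h
  have : (2 * m : ℤ) = 1 := by
    have : (2 * m : ℝ) = 1 := by linarith
    exact_mod_cast this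
  omega

theorem om_notMem : om ∉ gauss.lattice := by
  rw [mem_gauss_iff, om_re]
  rintro ⟨⟨m, hm⟩, -⟩
  exact half_ne_int m hm

theorem half_notMem : (1 / 2 : ℂ) ∉ gauss.lattice := gauss.ω₁_div_two_notMem_lattice

theorem two_mul_om_mem : om + om ∈ gauss.lattice := mem_gauss.2 ⟨1, 1, by simp [om]⟩

theorem derivWeierstrassP_eq_zero {L : PeriodPair} {z : ℂ} (h : z + z ∈ L.lattice) :
    L.derivWeierstrassP z = 0 := by
  have h1 := L.derivWeierstrassP_add_coe (-z) ⟨_, h⟩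
  simp only [L.derivWeierstrassP_neg, neg_add_cancel_left] at h1
  exact CharZero.eq_neg_self_iff.1 h1

/-- When `℘'` vanishes at `z`, the pair `(℘, ℘')` does not distinguish `z` from `-z`. -/
theorem add_self_mem_of_derivWeierstrassP_eq_zero {L : PeriodPair} {z : ℂ} (hz : z ∉ L.lattice)
    (h : L.derivWeierstrassP z = 0) : z + z ∈ L.lattice := by
  simpa using L.sub_mem_lattice hz (b := -z) (by simpa using hz) (by simp) (by simp [h])

theorem derivWeierstrassP_om : gauss.derivWeierstrassP om = 0 :=
  derivWeierstrassP_eq_zero two_mul_om_mem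

/-- The point `i * om = om - 1` is congruent to `om`, while multiplication by `i` changes the sign
of `℘`. -/
theorem weierstrassP_om : gauss.weierstrassP om = 0 := by
  have h1 := weierstrassP_I_mul om
  have h2 : I * om = om - ((⟨1, mem_gauss.2 ⟨1, 0, by simp⟩⟩ : gauss.lattice) : ℂ) := by
    simp only [om]
    linear_combination I_mul_I / 2
  rw [h2, gauss.weierstrassP_sub_coe] at h1
  exact CharZero.eq_neg_self_iff.1 h1

theorem derivWeierstrassP_sq (z : ℂ) (hz : z ∉ gauss.lattice) :
    gauss.derivWeierstrassP z ^ 2 =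
      4 * gauss.weierstrassP z ^ 3 - gauss.g₂ * gauss.weierstrassP z := by
  rw [gauss.derivWeierstrassP_sq z hz, gauss_g₃, sub_zero]

theorem weierstrassP_eq_zero {z : ℂ} (hz : z ∉ gauss.lattice) (h : gauss.weierstrassP z = 0) :
    z - om ∈ gauss.lattice := by
  refine gauss.sub_mem_lattice hz om_notMem (by rw [h, weierstrassP_om]) ?_
  have := derivWeierstrassP_sq z hz
  rw [h] at this
  simpa [derivWeierstrassP_om] using this

/-- The real value `halfValue = ℘(1/2)`. -/
noncomputable def halfValue : ℝ := (gauss.weierstrassP (1 / 2)).re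

theorem weierstrassP_ofReal (x : ℝ) : ((gauss.weierstrassP x).re : ℂ) = gauss.weierstrassP x := by
  rw [← conj_eq_iff_re, ← weierstrassP_conj, conj_ofReal]

theorem derivWeierstrassP_ofReal (x : ℝ) :
    ((gauss.derivWeierstrassP x).re : ℂ) = gauss.derivWeierstrassP x := by
  rw [← conj_eq_iff_re, ← derivWeierstrassP_conj, conj_ofReal]

theorem weierstrassP_half : gauss.weierstrassP (1 / 2) = halfValue := by
  have := weierstrassP_ofReal (1 / 2)
  push_cast at this
  exact this.symm

theorem halfValue_ne_zero : halfValue ≠ 0 := by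
  intro h
  have h1 := weierstrassP_eq_zero half_notMem (by rw [weierstrassP_half, h, ofReal_zero])
  obtain ⟨-, n, hn⟩ := mem_gauss_iff.1 h1
  simp only [sub_im, om_im] at hn
  refine half_ne_int (-n) ?_
  push_cast
  rw [hn]
  norm_num

theorem gauss_g₂ : PeriodPair.g₂ gauss = 4 * halfValue ^ 2 := by
  have h := derivWeierstrassP_sq _ half_notMem
  have h1 : gauss.derivWeierstrassP (1 / 2) = 0 :=
    derivWeierstrassP_eq_zero (mem_gauss.2 ⟨1, 0, by norm_num⟩)
  rw [h1, weierstrassP_half] at h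
  have h2 : (halfValue : ℂ) ≠ 0 := ofReal_ne_zero.2 halfValue_ne_zero
  apply mul_right_cancel₀ h2
  linear_combination h

theorem ofReal_notMem {x : ℝ} (hx : x ∈ Set.Ioc 0 (1 / 2)) : (x : ℂ) ∉ gauss.lattice := by
  rw [mem_gauss_iff]
  rintro ⟨⟨m, hm⟩, -⟩
  simp only [ofReal_re] at hm
  obtain ⟨h1, h2⟩ := hx
  rw [← hm] at h1 h2
  have h3 : 0 < m := by exact_mod_cast h1
  have h4 : (m : ℝ) < 1 := by linarith
  have h5 : m < 1 := by exact_mod_cast h4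
  omega

/-- The function `℘` on the real line. -/
noncomputable def realP (x : ℝ) : ℝ := (gauss.weierstrassP x).re

/-- The function `℘'` on the real line. -/
noncomputable def realP' (x : ℝ) : ℝ := (gauss.derivWeierstrassP x).re

theorem realP_half : realP (1 / 2) = halfValue := by simp [realP, halfValue]

theorem hasDerivAt_realP {x : ℝ} (hx : x ∈ Set.Ioc 0 (1 / 2)) : HasDerivAt realP (realP' x) x :=
  (gauss.hasDerivAt_weierstrassP (ofReal_notMem hx)).real_of_complex

theorem realP'_sq {x : ℝ} (hx : x ∈ Set.Ioc 0 (1 / 2)) :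
    realP' x ^ 2 = 4 * realP x * (realP x ^ 2 - halfValue ^ 2) := by
  have h := derivWeierstrassP_sq x (ofReal_notMem hx)
  rw [← weierstrassP_ofReal, ← derivWeierstrassP_ofReal, gauss_g₂] at h
  have h' : realP' x ^ 2 = 4 * realP x ^ 3 - 4 * halfValue ^ 2 * realP x := by exact_mod_cast h
  linear_combination h'

theorem realP_ne_zero {x : ℝ} (hx : x ∈ Set.Ioc 0 (1 / 2)) : realP x ≠ 0 := by
  intro h
  have h1 := weierstrassP_eq_zero (ofReal_notMem hx)
    (by rw [← weierstrassP_ofReal]; exact_mod_cast h)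
  obtain ⟨-, n, hn⟩ := mem_gauss_iff.1 h1
  simp only [sub_im, om_im, ofReal_im] at hn
  refine half_ne_int (-n) ?_
  push_cast
  rw [hn]
  norm_num

theorem realP'_ne_zero {x : ℝ} (hx : x ∈ Set.Ioo 0 (1 / 2)) : realP' x ≠ 0 := by
  intro h
  have hx' := Set.Ioo_subset_Ioc_self hx
  have h1 := add_self_mem_of_derivWeierstrassP_eq_zero (ofReal_notMem hx')
    (by rw [← derivWeierstrassP_ofReal]; exact_mod_cast h)
  obtain ⟨⟨m, hm⟩, -⟩ := mem_gauss_iff.1 h1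
  simp only [add_re, ofReal_re] at hm
  have h3 : 0 < (m : ℝ) := by linarith [hx.1]
  have h4 : (m : ℝ) < 1 := by linarith [hx.2]
  have h3 : 0 < m := by exact_mod_cast h3
  have h4 : m < 1 := by exact_mod_cast h4
  omega

/-- Equal values of `℘` force `℘'` to agree up to sign, so `x - y` or `x + y` is a lattice point;
their size leaves only `x = y`. -/
theorem injOn_realP : Set.InjOn realP (Set.Ioo 0 (1 / 2)) := by
  intro x hx y hy h
  have hx' := ofReal_notMem (Set.Ioo_subset_Ioc_self hx)
  have hy' := ofReal_notMem (Set.Ioo_subset_Ioc_self hy)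
  have hxy : gauss.weierstrassP x = gauss.weierstrassP y := by
    rw [← weierstrassP_ofReal, ← weierstrassP_ofReal y]
    exact_mod_cast h
  have h2 : gauss.derivWeierstrassP x ^ 2 = gauss.derivWeierstrassP y ^ 2 := by
    rw [derivWeierstrassP_sq _ hx', derivWeierstrassP_sq _ hy', hxy]
  obtain ⟨hx1, hx2⟩ := hx
  obtain ⟨hy1, hy2⟩ := hy
  rcases sq_eq_sq_iff_eq_or_eq_neg.1 h2 with h3 | h3
  · obtain ⟨⟨m, hm⟩, -⟩ := mem_gauss_iff.1 (gauss.sub_mem_lattice hx' hy' hxy h3)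
    simp only [sub_re, ofReal_re] at hm
    have h5 : (-1 : ℝ) < m := by linarith
    have h6 : (m : ℝ) < 1 := by linarith
    have h5 : -1 < m := by exact_mod_cast h5
    have h6 : m < 1 := by exact_mod_cast h6
    obtain rfl : m = 0 := by omega
    push_cast at hm
    linarith
  · obtain ⟨⟨m, hm⟩, -⟩ := mem_gauss_iff.1 (gauss.sub_mem_lattice hx' (b := -y) (by simpa using hy')
      (by simpa using hxy) (by simpa using h3))
    simp only [sub_re, neg_re, ofReal_re] at hm
    have h5 : (0 : ℝ) < m := by linarith
    have h6 : (m : ℝ) < 1 := by linarith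
    have h5 : 0 < m := by exact_mod_cast h5
    have h6 : m < 1 := by exact_mod_cast h6
    omega

theorem tendsto_abs_realP : Tendsto (fun x ↦ |realP x|) (𝓝[>] 0) atTop := by
  have h1 : Tendsto (fun x : ℝ ↦ (x : ℂ)) (𝓝[>] 0) (𝓝[≠] 0) := by
    refine tendsto_nhdsWithin_iff.2 ⟨?_, ?_⟩
    · simpa using (continuous_ofReal.tendsto 0).mono_left nhdsWithin_le_nhds
    · filter_upwards [self_mem_nhdsWithin] with x hx
      simpa using (ne_of_gt hx : x ≠ 0)
  have h2 := tendsto_norm_cobounded_atTop.comp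
    ((gauss.tendsto_weierstrassP_cobounded (zero_mem _)).comp h1)
  refine h2.congr fun x ↦ ?_
  simp only [Function.comp_apply]
  rw [← weierstrassP_ofReal, norm_real]
  rfl

theorem continuousOn_realP : ContinuousOn realP (Set.Ioc 0 (1 / 2)) :=
  fun _ hx ↦ (hasDerivAt_realP hx).continuousAt.continuousWithinAt

/-- If `e < 0`, then `℘`, having no zero on the segment, is negative there. Then `℘' ^ 2 ≥ 0` forces
`|℘| ≤ |e|`, contradicting the pole at `0`. -/
theorem halfValue_pos : 0 < halfValue := by
  by_contra! he
  have he' : realP (1 / 2) < 0 := by rw [realP_half]; exact lt_of_le_of_ne he halfValue_ne_zero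
  have hneg : ∀ x ∈ Set.Ioc (0 : ℝ) (1 / 2), realP x < 0 := by
    intro x hx
    by_contra! hx0
    have := intermediate_value_Icc' hx.2
      (continuousOn_realP.mono fun y hy ↦ ⟨hx.1.trans_le hy.1, hy.2⟩)
      (show (0 : ℝ) ∈ Set.Icc _ _ from ⟨he'.le, hx0⟩)
    obtain ⟨y, hy, hy0⟩ := this
    exact realP_ne_zero ⟨hx.1.trans_le hy.1, hy.2⟩ hy0
  have hb : ∀ x ∈ Set.Ioc (0 : ℝ) (1 / 2), |realP x| ≤ |halfValue| := by
    intro x hx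
    rw [← sq_le_sq]
    by_contra! hlt
    nlinarith [realP'_sq hx, sq_nonneg (realP' x), hneg x hx, mul_pos_of_neg_of_neg (hneg x hx)
      (sub_neg.2 hlt)]
  obtain ⟨x, hx1, hx2⟩ := ((tendsto_abs_realP.eventually_gt_atTop |halfValue|).and
    (Ioc_mem_nhdsGT (show (0 : ℝ) < 1 / 2 by norm_num))).exists
  exact absurd (hb x hx2) (not_le.2 hx1)

theorem halfValue_le_realP {x : ℝ} (hx : x ∈ Set.Ioc 0 (1 / 2)) : halfValue ≤ realP x := by
  have hpos : 0 < realP x := by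
    by_contra! hx0
    obtain ⟨y, hy, hy0⟩ := intermediate_value_Icc hx.2
      (continuousOn_realP.mono fun y hy ↦ ⟨hx.1.trans_le hy.1, hy.2⟩)
      (show (0 : ℝ) ∈ Set.Icc _ _ from ⟨hx0, by rw [realP_half]; exact halfValue_pos.le⟩)
    exact realP_ne_zero ⟨hx.1.trans_le hy.1, hy.2⟩ hy0
  by_contra! h
  have h1 := realP'_sq hx
  have h2 : realP x ^ 2 < halfValue ^ 2 := by gcongr
  nlinarith [sq_nonneg (realP' x), mul_pos hpos (sub_pos.2 h2)]

theorem halfValue_lt_realP {x : ℝ} (hx : x ∈ Set.Ioo 0 (1 / 2)) : halfValue < realP x := by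
  refine lt_of_le_of_ne (halfValue_le_realP (Set.Ioo_subset_Ioc_self hx)) fun h ↦
    realP'_ne_zero hx ?_
  have := realP'_sq (Set.Ioo_subset_Ioc_self hx)
  rw [← h] at this
  simpa using this

end QuarticCurve

/-! ### Evaluation of the beta integral in terms of `℘(1/2)` -/

namespace QuarticCurve

open Complex ComplexConjugate MeasureTheory

/-- The substitution `(℘(1/2) / ℘) ^ 2` on `[0, 1/2]`. -/
noncomputable def ratioSq (x : ℝ) : ℝ := (halfValue / realP x) ^ 2

theorem hasDerivAt_ratioSq {x : ℝ} (hx : x ∈ Set.Ioc 0 (1 / 2)) :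
    HasDerivAt ratioSq (2 * (halfValue / realP x) * (-(halfValue * realP' x) / realP x ^ 2)) x := by
  have h := ((hasDerivAt_const x halfValue).div (hasDerivAt_realP hx) (realP_ne_zero hx)).pow 2
  refine h.congr_deriv ?_
  simp

theorem ratioSq_mem {x : ℝ} (hx : x ∈ Set.Ioo 0 (1 / 2)) : ratioSq x ∈ Set.Ioo 0 1 := by
  have h1 := halfValue_lt_realP hx
  have h0 := halfValue_pos
  have h2 : 0 < halfValue / realP x := div_pos h0 (h0.trans h1)
  have h3 : halfValue / realP x < 1 := (div_lt_one (h0.trans h1)).2 h1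
  exact ⟨by unfold ratioSq; positivity, by unfold ratioSq; exact pow_lt_one₀ h2.le h3 two_ne_zero⟩

theorem image_ratioSq : ratioSq '' Set.Ioo 0 (1 / 2) = Set.Ioo 0 1 := by
  apply Set.Subset.antisymm
  · rintro _ ⟨x, hx, rfl⟩
    exact ratioSq_mem hx
  · intro y hy
    have h0 : Tendsto ratioSq (𝓝[>] 0) (𝓝 0) := by
      have h1 : Tendsto (fun x ↦ (halfValue / |realP x|) ^ 2) (𝓝[>] 0) (𝓝 (0 ^ 2)) :=
        (tendsto_const_nhds.div_atTop tendsto_abs_realP).pow 2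
      rw [zero_pow two_ne_zero] at h1
      refine h1.congr fun x ↦ ?_
      rw [ratioSq, div_pow, div_pow, sq_abs]
    obtain ⟨a, ha1, ha2⟩ := ((h0.eventually_lt_const hy.1).and
      (Ioo_mem_nhdsGT (show (0 : ℝ) < 1 / 2 by norm_num))).exists
    have hhalf : ratioSq (1 / 2) = 1 := by
      rw [ratioSq, realP_half, div_self halfValue_ne_zero, one_pow]
    obtain ⟨x, hx, hxy⟩ := intermediate_value_Ioo ha2.2.le (f := ratioSq)
      (fun z hz ↦ (hasDerivAt_ratioSq ⟨ha2.1.trans_le hz.1, hz.2⟩).continuousAt.continuousWithinAt)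
      (show y ∈ Set.Ioo _ _ from ⟨ha1, by rw [hhalf]; exact hy.2⟩)
    exact ⟨x, ⟨ha2.1.trans hx.1, hx.2⟩, hxy⟩

theorem injOn_ratioSq : Set.InjOn ratioSq (Set.Ioo 0 (1 / 2)) := by
  intro x hx y hy h
  apply injOn_realP hx hy
  have h0 := halfValue_pos
  have h1 := h0.trans (halfValue_lt_realP hx)
  have h2 := h0.trans (halfValue_lt_realP hy)
  have h3 : halfValue / realP x = halfValue / realP y :=
    (pow_left_inj₀ (by positivity) (by positivity) two_ne_zero).1 h
  rw [div_eq_div_iff h1.ne' h2.ne'] at h3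
  exact (mul_left_cancel₀ h0.ne' h3).symm

/-- By the differential equation, the substitution makes the beta integrand constant. Comparing
squares avoids determining the sign of `℘'` and handling fractional powers. -/
theorem abs_deriv_ratioSq_mul {x : ℝ} (hx : x ∈ Set.Ioo 0 (1 / 2)) :
    |2 * (halfValue / realP x) * (-(halfValue * realP' x) / realP x ^ 2)| *
      (ratioSq x ^ (-3 / 4 : ℝ) * (1 - ratioSq x) ^ (-1 / 2 : ℝ)) = 4 * √halfValue := by
  have h0 := halfValue_pos
  have h1 := h0.trans (halfValue_lt_realP hx)
  obtain ⟨hy0, hy1⟩ := ratioSq_mem hx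
  have hr : 0 < halfValue / realP x := by positivity
  have hA : (ratioSq x ^ (-3 / 4 : ℝ)) ^ 2 = ((halfValue / realP x) ^ 3)⁻¹ := by
    rw [← Real.rpow_natCast, ← Real.rpow_mul hy0.le, ratioSq, ← Real.rpow_natCast,
      ← Real.rpow_mul hr.le, ← Real.rpow_natCast, ← Real.rpow_neg hr.le]
    norm_num
  have hB : ((1 - ratioSq x) ^ (-1 / 2 : ℝ)) ^ 2 = (1 - ratioSq x)⁻¹ := by
    rw [← Real.rpow_natCast, ← Real.rpow_mul (by linarith), ← Real.rpow_neg_one]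
    norm_num
  have hC := realP'_sq (Set.Ioo_subset_Ioc_self hx)
  have hne : realP x ^ 2 - halfValue ^ 2 ≠ 0 := by
    have := halfValue_lt_realP hx
    have : halfValue ^ 2 < realP x ^ 2 := by gcongr
    linarith
  rw [← pow_left_inj₀ (n := 2) (mul_nonneg (abs_nonneg _) (mul_nonneg (by positivity)
    (Real.rpow_nonneg (by linarith) _))) (by positivity) two_ne_zero, mul_pow, mul_pow, sq_abs,
    hA, hB, mul_pow 4, Real.sq_sqrt h0.le, ratioSq]
  have h5 : 1 - (halfValue / realP x) ^ 2 = (realP x ^ 2 - halfValue ^ 2) / realP x ^ 2 := by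
    field_simp
  rw [h5]
  have h6 : (2 * (halfValue / realP x) * (-(halfValue * realP' x) / realP x ^ 2)) ^ 2 =
    4 * halfValue ^ 4 / realP x ^ 6 * realP' x ^ 2 := by
    field_simp
    ring
  rw [h6, hC]
  field_simp

theorem betaIntegral_quarter_half : betaIntegral (1 / 4) (1 / 2) = 2 * √halfValue := by
  have hreal : ∫ y in Set.Ioo (0 : ℝ) 1, y ^ (-3 / 4 : ℝ) * (1 - y) ^ (-1 / 2 : ℝ) =
      2 * √halfValue := by
    rw [← image_ratioSq, integral_image_eq_integral_abs_deriv_smul measurableSet_Ioo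
      (fun x hx ↦ (hasDerivAt_ratioSq (Set.Ioo_subset_Ioc_self hx)).hasDerivWithinAt)
      injOn_ratioSq]
    simp only [smul_eq_mul]
    rw [setIntegral_congr_fun measurableSet_Ioo fun x hx ↦ abs_deriv_ratioSq_mul hx]
    simp
    ring
  rw [betaIntegral, intervalIntegral.integral_of_le zero_le_one, integral_Ioc_eq_integral_Ioo]
  have : ∀ y ∈ Set.Ioo (0 : ℝ) 1, (y : ℂ) ^ ((1 / 4 : ℂ) - 1) * (1 - (y : ℂ)) ^ ((1 / 2 : ℂ) - 1) =
      ((y ^ (-3 / 4 : ℝ) * (1 - y) ^ (-1 / 2 : ℝ) : ℝ) : ℂ) := by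
    intro y hy
    rw [ofReal_mul, ofReal_cpow hy.1.le, ofReal_cpow (sub_nonneg.2 hy.2.le)]
    push_cast
    norm_num
  rw [setIntegral_congr_fun measurableSet_Ioo this, integral_complex_ofReal, hreal]
  push_cast
  ring

/-- The reflection formula at `1/4` and `1/2` gives `B(1/4, 1/4) sin(π/4) = B(1/4, 1/2) = 2 √e`. -/
theorem betaIntegral_quarter_sq : betaIntegral (1 / 4) (1 / 4) ^ 2 = 8 * halfValue := by
  have h1 := Gamma_mul_Gamma_eq_betaIntegral (s := 1 / 4) (t := 1 / 4) (by norm_num) (by norm_num)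
  have h2 := Gamma_mul_Gamma_eq_betaIntegral (s := 1 / 4) (t := 1 / 2) (by norm_num) (by norm_num)
  have h3 := Gamma_mul_Gamma_one_sub (1 / 4)
  have h4 := Gamma_mul_Gamma_one_sub (1 / 2)
  rw [show (1 / 4 + 1 / 4 : ℂ) = 1 / 2 by norm_num] at h1
  rw [show (1 / 4 + 1 / 2 : ℂ) = 3 / 4 by norm_num, betaIntegral_quarter_half] at h2
  rw [show (1 - 1 / 4 : ℂ) = 3 / 4 by norm_num] at h3
  rw [show (1 - 1 / 2 : ℂ) = 1 / 2 by norm_num] at h4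
  have h5 : sin (Real.pi * (1 / 4)) ^ 2 = 1 / 2 := by
    have : (Real.pi * (1 / 4) : ℂ) = ((Real.pi / 4 : ℝ) : ℂ) := by push_cast; ring
    rw [this, ← ofReal_sin, Real.sin_pi_div_four]
    norm_cast
    rw [div_pow, Real.sq_sqrt two_pos.le]
    norm_num
  have h6 : sin (Real.pi * (1 / 2)) = 1 := by
    have : (Real.pi * (1 / 2) : ℂ) = Real.pi / 2 := by ring
    rw [this, sin_pi_div_two]
  rw [h6, div_one] at h4
  have hpi : (Real.pi : ℂ) ≠ 0 := ofReal_ne_zero.2 Real.pi_ne_zero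
  have hs : sin (Real.pi * (1 / 4)) ≠ 0 := by
    intro h
    rw [h] at h5
    norm_num at h5
  rw [eq_div_iff hs] at h3
  have he : ((√halfValue : ℝ) : ℂ) ^ 2 = halfValue := by
    rw [← ofReal_pow, Real.sq_sqrt halfValue_pos.le]
  generalize Gamma (1 / 4) = g₁ at *
  generalize Gamma (1 / 2) = g₂ at *
  generalize Gamma (3 / 4) = g₃ at *
  generalize sin (Real.pi * (1 / 4)) = s at *
  generalize betaIntegral (1 / 4) (1 / 4) = B at *
  have h7 : Real.pi * (B * s) = Real.pi * (2 * √halfValue) := by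
    have h8 : g₁ * g₁ * g₂ = Real.pi * B := by linear_combination g₂ * h1 + B * h4
    have h9 : g₁ * g₂ * (g₁ * s) = Real.pi * (2 * √halfValue) := by
      linear_combination g₁ * s * h2 + 2 * √halfValue * h3
    linear_combination h9 - s * h8
  have h10 := mul_left_cancel₀ hpi h7
  linear_combination (2 * B * s + 4 * √halfValue) * h10 - 2 * B ^ 2 * h5 + 8 * he

/-- The normalizing constant `(1 - i) B(1/4, 1/4)`. -/
noncomputable def normConst : ℂ := (1 - I) * betaIntegral (1 / 4) (1 / 4)

theorem normConst_sq : normConst ^ 2 = -16 * I * halfValue := by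
  rw [normConst, mul_pow, betaIntegral_quarter_sq]
  linear_combination 8 * (halfValue : ℂ) * I_sq

theorem halfValue_ne_zero' : (halfValue : ℂ) ≠ 0 := ofReal_ne_zero.2 halfValue_ne_zero

theorem normConst_ne_zero : normConst ≠ 0 := by
  intro h
  have := normConst_sq
  rw [h] at this
  simp [halfValue_ne_zero] at this

end QuarticCurve

/-! ### The coordinate functions `W`, `U` and multiplication by `1 + i` -/

namespace QuarticCurve

open Complex

/-- The function `w` in terms of the elliptic integral. -/
noncomputable def W (z : ℂ) : ℂ := I / halfValue * gauss.weierstrassP (z + om)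

/-- The function `u` in terms of the elliptic integral. -/
noncomputable def U (z : ℂ) : ℂ :=
  2 * I / (halfValue * normConst) * gauss.derivWeierstrassP (z + om)

theorem U_sq {z : ℂ} (hz : z + om ∉ gauss.lattice) : U z ^ 2 = W z ^ 3 + W z := by
  have h := derivWeierstrassP_sq _ hz
  rw [gauss_g₂] at h
  have h1 := halfValue_ne_zero'
  simp only [U, W, mul_pow, div_pow, h, normConst_sq, I_sq, I_pow_three]
  have h2 := I_ne_zero
  field_simp
  linear_combination (16 * gauss.weierstrassP (z + om) ^ 3 -
    16 * gauss.weierstrassP (z + om) * (halfValue : ℂ) ^ 2) * I_sq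

theorem hasDerivAt_W {z : ℂ} (hz : z + om ∉ gauss.lattice) :
    HasDerivAt W (normConst / 2 * U z) z := by
  refine (((gauss.hasDerivAt_weierstrassP hz).comp_add_const z om).const_mul
    (I / (halfValue : ℂ))).congr_deriv ?_
  have h1 := halfValue_ne_zero'
  have h2 := normConst_ne_zero
  simp only [U]
  field_simp

theorem hasDerivAt_U {z : ℂ} (hz : z + om ∉ gauss.lattice) :
    HasDerivAt U (normConst / 4 * (3 * W z ^ 2 + 1)) z := by
  refine (((gauss.hasDerivAt_derivWeierstrassP hz).comp_add_const z om).const_mul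
    (2 * I / (halfValue * normConst))).congr_deriv ?_
  have h1 := halfValue_ne_zero'
  have h2 := normConst_ne_zero
  have h3 := normConst_sq
  rw [gauss_g₂]
  simp only [W]
  rw [div_mul_eq_mul_div, div_eq_iff (by positivity)]
  have : normConst / 4 * (3 * (I / ↑halfValue * gauss.weierstrassP (z + om)) ^ 2 + 1) *
    (↑halfValue * normConst) = normConst ^ 2 / 4 *
      (3 * (I / ↑halfValue * gauss.weierstrassP (z + om)) ^ 2 + 1) * ↑halfValue := by ring
  rw [this, h3, mul_pow, div_pow, I_sq]
  field_simp
  ring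

theorem W_zero : W 0 = 0 := by simp [W, weierstrassP_om]

theorem U_zero : U 0 = 0 := by simp [U, derivWeierstrassP_om]

theorem W_add {z l : ℂ} (hl : l ∈ gauss.lattice) : W (z + l) = W z := by
  rw [W, add_right_comm, gauss.weierstrassP_add_coe _ ⟨l, hl⟩, W]

theorem U_add {z l : ℂ} (hl : l ∈ gauss.lattice) : U (z + l) = U z := by
  rw [U, add_right_comm, gauss.derivWeierstrassP_add_coe _ ⟨l, hl⟩, U]

theorem sub_mem_of_W_eq {a b : ℂ} (ha : a + om ∉ gauss.lattice) (hb : b + om ∉ gauss.lattice)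
    (h : W a = W b) (h' : U a = U b) : a - b ∈ gauss.lattice := by
  have h1 := halfValue_ne_zero'
  have h2 := normConst_ne_zero
  have := gauss.sub_mem_lattice ha hb (mul_left_cancel₀ (by simp [h1]) h)
    (mul_left_cancel₀ (by simp [h1, h2]) h')
  simpa using this

theorem exists_W_eq {w u : ℂ} (h : u ^ 2 = w ^ 3 + w) :
    ∃ z, z + om ∉ gauss.lattice ∧ W z = w ∧ U z = u := by
  have h1 := halfValue_ne_zero'
  obtain ⟨x, hx, hxw⟩ := gauss.exists_weierstrassP_eq (w / (I / halfValue))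
  have hI := I_ne_zero
  have hx' : x - om + om ∉ gauss.lattice := by simpa using hx
  have hW : W (x - om) = w := by
    rw [W, sub_add_cancel, hxw]
    field_simp
  have hU := U_sq hx'
  rw [hW, ← h] at hU
  rcases sq_eq_sq_iff_eq_or_eq_neg.1 hU with hU | hU
  · exact ⟨_, hx', hW, hU⟩
  -- The reflection `x ↦ -x` keeps `℘` and changes the sign of `℘'`, which corrects the sign of `U`.
  · refine ⟨-x - om, by simpa using hx, ?_, ?_⟩
    · simpa [W] using hW
    · simpa [U, neg_eq_iff_eq_neg] using hU

theorem tendsto_W_cobounded {z : ℂ} (hz : z + om ∈ gauss.lattice) :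
    Tendsto W (𝓝[≠] z) (Bornology.cobounded ℂ) := by
  have h1 : Tendsto (fun x ↦ x + om) (𝓝[≠] z) (𝓝[≠] (z + om)) := by
    refine tendsto_nhdsWithin_iff.2 ⟨?_, ?_⟩
    · exact ((continuous_add_const om).tendsto z).mono_left nhdsWithin_le_nhds
    · filter_upwards [self_mem_nhdsWithin] with x hx
      simpa using hx
  exact (tendsto_mul_left_cobounded (by simp [halfValue_ne_zero])).comp
    ((gauss.tendsto_weierstrassP_cobounded hz).comp h1)

/-- The set of poles of `W` and `U`. -/
def poles : Set ℂ := {z | z + om ∈ gauss.lattice}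

theorem countable_poles : poles.Countable :=
  gauss.countable_lattice.preimage (add_left_injective om)

theorem isClosed_poles : IsClosed poles :=
  gauss.isClosed_lattice.preimage (continuous_add_const om)

theorem eventually_notMem_poles (z : ℂ) : ∀ᶠ x in 𝓝[≠] z, x ∉ poles := by
  have h1 : Tendsto (fun x ↦ x + om) (𝓝[≠] z) (𝓝[≠] (z + om)) := by
    refine tendsto_nhdsWithin_iff.2 ⟨?_, ?_⟩
    · exact ((continuous_add_const om).tendsto z).mono_left nhdsWithin_le_nhds
    · filter_upwards [self_mem_nhdsWithin] with x hx
      simpa using hx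
  exact h1.eventually (gauss.eventually_notMem_lattice _)

theorem zero_notMem_poles : (0 : ℂ) ∉ poles := by simpa [poles] using om_notMem

theorem analyticOnNhd_W : AnalyticOnNhd ℂ W polesᶜ := fun z hz ↦
  Complex.analyticAt_iff_eventually_differentiableAt.2 <| by
    filter_upwards [isClosed_poles.isOpen_compl.mem_nhds hz] with x hx
    exact (hasDerivAt_W hx).differentiableAt

theorem analyticOnNhd_U : AnalyticOnNhd ℂ U polesᶜ := fun z hz ↦
  Complex.analyticAt_iff_eventually_differentiableAt.2 <| by
    filter_upwards [isClosed_poles.isOpen_compl.mem_nhds hz] with x hx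
    exact (hasDerivAt_U hx).differentiableAt

theorem one_add_I_ne_zero : (1 + I) ≠ 0 := by
  intro h
  simpa using congrArg re h

/-- Multiplication by `1 + i`, near the base point. -/
theorem eventually_W_mul : ∀ᶠ z in 𝓝 (0 : ℂ),
    W ((1 + I) * z) * (W z ^ 2 + 1) = 2 * I * W z ∧
      U ((1 + I) * z) * (W z ^ 2 + 1) ^ 2 = (1 + I) * (U z * (1 - W z ^ 2)) := by
  have hopen := isClosed_poles.isOpen_compl.mem_nhds zero_notMem_poles
  have hmul : Tendsto (fun z : ℂ ↦ (1 + I) * z) (𝓝 0) (𝓝 0) := by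
    simpa using (continuous_const_mul (1 + I)).tendsto 0
  have hW0 : ContinuousAt W 0 := (hasDerivAt_W zero_notMem_poles).continuousAt
  have hne : ∀ᶠ z in 𝓝 (0 : ℂ), W z ^ 2 + 1 ≠ 0 :=
    ((hW0.pow 2).add continuousAt_const).eventually_ne (by simp [W_zero])
  -- Both pairs satisfy the system of `(W, U)` with the right-hand side scaled by `1 + i`, and both
  -- start at `(0, 0)`.
  have key := Complex.ode_solution_unique (a := 0)
    (v := fun p : ℂ × ℂ ↦ ((1 + I) * (normConst / 2 * p.2),
      (1 + I) * (normConst / 4 * (3 * p.1 ^ 2 + 1))))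
    (F := fun z ↦ (W ((1 + I) * z), U ((1 + I) * z)))
    (G := fun z ↦ (2 * I * W z / (W z ^ 2 + 1),
      (1 + I) * (U z * (1 - W z ^ 2)) / (W z ^ 2 + 1) ^ 2)) (by fun_prop)
    (by
      filter_upwards [hmul.eventually_mem hopen] with z hz
      have hd : HasDerivAt (fun z : ℂ ↦ (1 + I) * z) (1 + I) z := by
        simpa using (hasDerivAt_id z).const_mul (1 + I)
      have h1 := (hasDerivAt_W hz).comp z hd
      have h2 := (hasDerivAt_U hz).comp z hd
      refine (h1.prodMk h2).congr_deriv ?_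
      simp only [Prod.mk.injEq]
      constructor <;> ring)
    (by
      filter_upwards [hopen, hne] with z hz hz'
      have h1 := hasDerivAt_W hz
      have h2 := hasDerivAt_U hz
      have h3 := (h1.pow 2).add_const 1
      have h4 := (h1.const_mul (2 * I)).div h3 hz'
      have h5 := ((h2.mul ((h1.pow 2).const_sub 1)).const_mul (1 + I)).div (h3.pow 2)
        (pow_ne_zero 2 hz')
      refine (h4.prodMk h5).congr_deriv ?_
      have h6 := U_sq hz
      simp only [Prod.mk.injEq, Pi.pow_apply, Pi.mul_apply, Nat.cast_ofNat, Nat.add_one_sub_one,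
        pow_one]
      constructor
      · field_simp
        linear_combination normConst * U z * (W z ^ 2 - 1) * I_sq
      · field_simp
        simp only [h6, I_sq]
        ring)
    (by simp [W_zero, U_zero])
  filter_upwards [key, hne] with z hz hz'
  simp only [Prod.mk.injEq] at hz
  rw [hz.1, hz.2]
  constructor <;> field_simp

/-- The denominators stay cleared so that both sides remain analytic at the zeros of `W ^ 2 + 1`. -/
theorem W_mul {z : ℂ} (hz : z ∉ poles) (hz' : (1 + I) * z ∉ poles) :
    W ((1 + I) * z) * (W z ^ 2 + 1) = 2 * I * W z ∧
      U ((1 + I) * z) * (W z ^ 2 + 1) ^ 2 = (1 + I) * (U z * (1 - W z ^ 2)) := by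
  have hcount : (poles ∪ (fun z ↦ (1 + I) * z) ⁻¹' poles).Countable :=
    countable_poles.union (countable_poles.preimage (mul_right_injective₀ one_add_I_ne_zero))
  have hpre := isPreconnected_compl_of_countable hcount
  have hW : AnalyticOnNhd ℂ W (poles ∪ (fun z ↦ (1 + I) * z) ⁻¹' poles)ᶜ :=
    fun x hx ↦ analyticOnNhd_W x fun h ↦ hx (.inl h)
  have hU : AnalyticOnNhd ℂ U (poles ∪ (fun z ↦ (1 + I) * z) ⁻¹' poles)ᶜ :=
    fun x hx ↦ analyticOnNhd_U x fun h ↦ hx (.inl h)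
  have hW' : AnalyticOnNhd ℂ (fun z ↦ W ((1 + I) * z))
      (poles ∪ (fun z ↦ (1 + I) * z) ⁻¹' poles)ᶜ := fun x hx ↦
    (analyticOnNhd_W ((1 + I) * x) fun h ↦ hx (.inr h)).comp (f := fun z ↦ (1 + I) * z) (by fun_prop)
  have hU' : AnalyticOnNhd ℂ (fun z ↦ U ((1 + I) * z))
      (poles ∪ (fun z ↦ (1 + I) * z) ⁻¹' poles)ᶜ := fun x hx ↦
    (analyticOnNhd_U ((1 + I) * x) fun h ↦ hx (.inr h)).comp (f := fun z ↦ (1 + I) * z) (by fun_prop)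
  have hmem : z ∈ (poles ∪ (fun z ↦ (1 + I) * z) ⁻¹' poles)ᶜ := by
    rintro (h | h)
    exacts [hz h, hz' h]
  have h0 : (0 : ℂ) ∈ (poles ∪ (fun z ↦ (1 + I) * z) ⁻¹' poles)ᶜ := by
    rintro (h | h)
    · exact zero_notMem_poles h
    · exact zero_notMem_poles (by simpa using h)
  constructor
  · exact AnalyticOnNhd.eqOn_of_preconnected_of_eventuallyEq
      (f := fun z ↦ W ((1 + I) * z) * (W z ^ 2 + 1)) (g := fun z ↦ 2 * I * W z)
      (hW'.mul ((hW.pow 2).add analyticOnNhd_const)) (analyticOnNhd_const.mul hW) hpre h0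
      (eventually_W_mul.mono fun z hz ↦ hz.1) hmem
  · exact AnalyticOnNhd.eqOn_of_preconnected_of_eventuallyEq
      (f := fun z ↦ U ((1 + I) * z) * (W z ^ 2 + 1) ^ 2)
      (g := fun z ↦ (1 + I) * (U z * (1 - W z ^ 2)))
      (hU'.mul (((hW.pow 2).add analyticOnNhd_const).pow 2))
      (analyticOnNhd_const.mul (hU.mul (analyticOnNhd_const.sub (hW.pow 2)))) hpre h0
      (eventually_W_mul.mono fun z hz ↦ hz.2) hmem

/-- `(1 + i) z` is a pole exactly if `W z = ± i`, for `z` not a pole. -/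
theorem mul_mem_poles_iff {z : ℂ} (hz : z ∉ poles) :
    (1 + I) * z ∈ poles ↔ W z ^ 2 + 1 = 0 := by
  have hWz : ContinuousAt W z := (hasDerivAt_W hz).continuousAt
  have hmul : ContinuousAt (fun z : ℂ ↦ (1 + I) * z) z := (continuous_const_mul (1 + I)).continuousAt
  constructor
  · intro h
    -- Near `z` the left side of the multiplication formula tends to infinity, while the right side
    -- would be continuous.
    by_contra hne
    have h1 : Tendsto (fun x ↦ (1 + I) * x) (𝓝[≠] z) (𝓝[≠] ((1 + I) * z)) := by
      refine tendsto_nhdsWithin_iff.2 ⟨hmul.tendsto.mono_left nhdsWithin_le_nhds, ?_⟩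
      filter_upwards [self_mem_nhdsWithin] with x hx
      simpa [one_add_I_ne_zero] using hx
    have h2 := (tendsto_W_cobounded h).comp h1
    have h3 : ContinuousAt (fun x ↦ 2 * I * W x / (W x ^ 2 + 1)) z :=
      (continuousAt_const.mul hWz).div ((hWz.pow 2).add continuousAt_const) hne
    refine (h3.tendsto.mono_left nhdsWithin_le_nhds).not_tendsto
      (Metric.disjoint_nhds_cobounded _) (h2.congr' ?_)
    filter_upwards [eventually_notMem_poles z, h1.eventually (eventually_notMem_poles _),
      mem_nhdsWithin_of_mem_nhds ((((hWz.pow 2).add continuousAt_const).eventually_ne hne))]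
      with x hx hx' hx2
    exact (eq_div_iff hx2).2 (W_mul hx hx').1
  · intro h
    by_contra h'
    have h1 := (W_mul hz h').1
    rw [h, mul_zero, eq_comm, mul_eq_zero] at h1
    rcases h1 with h1 | h1
    · simp at h1
    · simp [h1] at h

end QuarticCurve

/-! ### The homeomorphism from the torus to the curve, and lifting of paths -/

namespace QuarticCurve

open Complex

open Classical in
/-- The parametrization of the curve by the elliptic integral. -/
noncomputable def psi (z : ℂ) : Curve :=
  if h : z ∈ poles then pointInfty
  else ((⟨(W z ^ 2 + 1, U z, W z), by
    have hU := U_sq h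
    refine ⟨?_, ?_, ?_⟩ <;> simp only
    · rw [show (4 : ℕ) = 2 * 2 from rfl, pow_mul, hU]
      ring
    · rw [hU]
      ring
    · ring⟩ : affineCurve) : OnePoint affineCurve)

theorem psi_of_mem {z : ℂ} (h : z ∈ poles) : psi z = pointInfty := dif_pos h

theorem exists_psi_eq_coe {z : ℂ} (h : z ∉ poles) : ∃ P : affineCurve, psi z = (P : Curve) ∧
    tA P = W z ^ 2 + 1 ∧ uA P = U z ∧ wA P = W z :=
  ⟨_, dif_neg h, rfl, rfl, rfl⟩

theorem psi_eq_infty_iff {z : ℂ} : psi z = pointInfty ↔ z ∈ poles := by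
  refine ⟨fun h ↦ ?_, psi_of_mem⟩
  by_contra hz
  obtain ⟨P, hP, -⟩ := exists_psi_eq_coe hz
  exact OnePoint.coe_ne_infty P (hP.symm.trans h)

theorem affineCurve_ext {P Q : affineCurve} (hu : uA P = uA Q) (hw : wA P = wA Q) : P = Q := by
  have ht : tA P = tA Q := by
    have h1 := P.2.2.2
    have h2 := Q.2.2.2
    change wA P ^ 2 = tA P - 1 at h1
    change wA Q ^ 2 = tA Q - 1 at h2
    rw [hw] at h1
    linear_combination h2 - h1
  exact Subtype.ext (Prod.ext ht (Prod.ext hu hw))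

theorem t_psi {z : ℂ} (h : z ∉ poles) : t (psi z) = W z ^ 2 + 1 := by
  obtain ⟨P, hP, ht, -⟩ := exists_psi_eq_coe h
  rw [hP, ← ht]
  rfl

theorem u_psi {z : ℂ} (h : z ∉ poles) : u (psi z) = U z := by
  obtain ⟨P, hP, -, hu, -⟩ := exists_psi_eq_coe h
  rw [hP, ← hu]
  rfl

theorem psi_zero : psi 0 = pointOne := by
  obtain ⟨P, hP, -, hu, hw⟩ := exists_psi_eq_coe zero_notMem_poles
  rw [hP]
  refine congrArg _ (affineCurve_ext ?_ ?_)
  · rw [hu, U_zero]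
    rfl
  · rw [hw, W_zero]
    rfl

theorem mem_poles_add_iff {z l : ℂ} (hl : l ∈ gauss.lattice) : z + l ∈ poles ↔ z ∈ poles := by
  change z + l + om ∈ gauss.lattice ↔ z + om ∈ gauss.lattice
  rw [add_right_comm]
  exact Submodule.add_mem_iff_left _ hl

theorem psi_add {z l : ℂ} (hl : l ∈ gauss.lattice) : psi (z + l) = psi z := by
  by_cases h : z ∈ poles
  · rw [psi_of_mem h, psi_of_mem ((mem_poles_add_iff hl).2 h)]
  · obtain ⟨P, hP, -, hu, hw⟩ := exists_psi_eq_coe h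
    obtain ⟨Q, hQ, -, hu', hw'⟩ := exists_psi_eq_coe (mt (mem_poles_add_iff hl).1 h)
    rw [hP, hQ]
    exact congrArg _ (affineCurve_ext (by rw [hu, hu', U_add hl]) (by rw [hw, hw', W_add hl]))

theorem sub_mem_of_psi_eq {a b : ℂ} (h : psi a = psi b) : a - b ∈ gauss.lattice := by
  by_cases ha : a ∈ poles
  · have hb : b ∈ poles := psi_eq_infty_iff.1 (h ▸ psi_of_mem ha)
    simpa using sub_mem (show a + om ∈ gauss.lattice from ha) hb
  · have hb : b ∉ poles := fun hb ↦ ha (psi_eq_infty_iff.1 (h ▸ psi_of_mem hb))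
    obtain ⟨P, hP, -, hu, hw⟩ := exists_psi_eq_coe ha
    obtain ⟨Q, hQ, -, hu', hw'⟩ := exists_psi_eq_coe hb
    rw [hP, hQ] at h
    obtain rfl := OnePoint.coe_injective h
    exact sub_mem_of_W_eq ha hb (hw.symm.trans hw') (hu.symm.trans hu')

theorem surjective_psi : Function.Surjective psi := by
  intro P
  induction P using OnePoint.rec with
  | infty => exact ⟨-om, psi_of_mem (by simp [poles])⟩
  | coe P =>
    have h1 := P.2.2.1
    have h2 := P.2.2.2
    change tA P * wA P = uA P ^ 2 at h1
    change wA P ^ 2 = tA P - 1 at h2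
    obtain ⟨z, hz, hw, hu⟩ := exists_W_eq (w := wA P) (u := uA P)
      (by linear_combination -h1 - wA P * h2)
    obtain ⟨Q, hQ, -, hu', hw'⟩ := exists_psi_eq_coe hz
    exact ⟨z, hQ.trans (congrArg _ (affineCurve_ext (hu'.trans hu) (hw'.trans hw)))⟩

theorem continuous_wA : Continuous wA :=
  continuous_snd.comp (continuous_snd.comp continuous_subtype_val)

theorem continuous_psi : Continuous psi := by
  rw [continuous_iff_continuousAt]
  intro z
  by_cases hz : z ∈ poles
  · rw [ContinuousAt, psi_of_mem hz]
    intro s hs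
    have hs0 : pointInfty ∈ s := mem_of_mem_nhds hs
    have hs' := hs
    rw [pointInfty, OnePoint.nhds_infty_eq] at hs'
    obtain ⟨K, ⟨-, hK⟩, hKs⟩ :=
      hasBasis_coclosedCompact.mem_iff.1 (mem_map.1 (mem_sup.1 hs').1)
    -- A neighbourhood of the point at infinity omits only a compact set `K` of affine points; `w`
    -- is bounded on `K`, whereas `W` is unbounded at the pole.
    have hev : ∀ᶠ x in 𝓝[≠] z, W x ∉ wA '' K :=
      (tendsto_W_cobounded hz).eventually
        (Bornology.isBounded_def.1 (hK.image continuous_wA).isBounded)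
    have hev' := eventually_nhdsWithin_iff.1 (hev.and (eventually_notMem_poles z))
    rw [mem_map]
    filter_upwards [hev'] with x hx
    by_cases hxz : x = z
    · subst hxz
      rwa [Set.mem_preimage, psi_of_mem hz]
    · obtain ⟨h1, h2⟩ := hx hxz
      obtain ⟨P, hP, -, -, hw⟩ := exists_psi_eq_coe h2
      rw [Set.mem_preimage, hP]
      exact hKs fun hPK ↦ h1 ⟨P, hPK, hw⟩
  · have hopen := isClosed_poles.isOpen_compl
    have h1 : ContinuousOn psi polesᶜ := by
      rw [continuousOn_iff_continuous_domRestrict]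
      have h2 : polesᶜ.domRestrict psi = fun x : (polesᶜ : Set ℂ) ↦ ((⟨(W x ^ 2 + 1, U x, W x), by
          obtain ⟨P, -, ht, hu, hw⟩ := exists_psi_eq_coe x.2
          rw [← ht, ← hu, ← hw]
          exact P.2⟩ : affineCurve) : Curve) := by
        funext x
        exact dif_neg x.2
      rw [h2]
      have hW : Continuous fun x : (polesᶜ : Set ℂ) ↦ W x :=
        continuousOn_iff_continuous_domRestrict.1 analyticOnNhd_W.continuousOn
      have hU : Continuous fun x : (polesᶜ : Set ℂ) ↦ U x :=
        continuousOn_iff_continuous_domRestrict.1 analyticOnNhd_U.continuousOn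
      exact OnePoint.continuous_coe.comp (Continuous.subtype_mk
        (((hW.pow 2).add continuous_const).prodMk (hU.prodMk hW)) _)
    exact h1.continuousAt (hopen.mem_nhds hz)

theorem isClosed_affineCurve : IsClosed affineCurve := by
  refine IsClosed.inter ?_ (IsClosed.inter ?_ ?_) <;>
    exact isClosed_eq (by fun_prop) (by fun_prop)

/-- Local compactness makes the one-point compactification Hausdorff, as needed for `psiHomeomorph`.
-/
instance : LocallyCompactSpace affineCurve := isClosed_affineCurve.locallyCompactSpace

theorem mem_lattice_iff {z : ℂ} : z ∈ lattice ↔ z ∈ gauss.lattice := by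
  rw [lattice_eq_gauss]
  rfl

theorem torus_mk_eq_iff {a b : ℂ} : (a : Torus) = b ↔ a - b ∈ gauss.lattice := by
  rw [QuotientAddGroup.eq_iff_sub_mem, mem_lattice_iff]

instance : CompactSpace Torus := by
  have h := IsZLattice.isCompact_range_of_periodic gauss.lattice (fun z : ℂ ↦ (z : Torus))
    continuous_quot_mk (fun z w hw ↦ torus_mk_eq_iff.2 (by simpa using hw))
  refine ⟨?_⟩
  rwa [(QuotientAddGroup.mk_surjective (s := lattice)).range_eq] at h

/-- The parametrization of the curve by the torus. -/
noncomputable def psiTorus : Torus → Curve :=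
  Quotient.lift psi fun a b h ↦ by
    have h1 : (a : Torus) = b := Quotient.sound h
    rw [torus_mk_eq_iff] at h1
    rw [← psi_add (z := b) h1, add_sub_cancel]

theorem psiTorus_coe (z : ℂ) : psiTorus z = psi z := rfl

theorem bijective_psiTorus : Function.Bijective psiTorus := by
  constructor
  · intro a b
    induction a using QuotientAddGroup.induction_on
    induction b using QuotientAddGroup.induction_on
    exact fun h ↦ torus_mk_eq_iff.2 (sub_mem_of_psi_eq h)
  · intro P
    obtain ⟨z, rfl⟩ := surjective_psi P
    exact ⟨z, rfl⟩

theorem continuous_psiTorus : Continuous psiTorus := continuous_psi.quotient_lift _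

/-- The torus is homeomorphic to the curve. -/
noncomputable def psiHomeomorph : Torus ≃ₜ Curve :=
  Continuous.homeoOfEquivCompactToT2 (f := Equiv.ofBijective _ bijective_psiTorus)
    continuous_psiTorus

theorem isCoveringMap_torus_mk : IsCoveringMap (fun z : ℂ ↦ (z : Torus)) := by
  refine (AddSubgroup.isAddQuotientCoveringMap_of_comm lattice ?_).isCoveringMap
  rw [lattice_eq_gauss]
  exact ⟨inferInstanceAs (DiscreteTopology gauss.lattice)⟩

/-- Through `psiHomeomorph` the path moves to the torus, where it lifts along the covering by `ℂ`.
-/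
theorem exists_lift {P Q : Curve} (γ : Path P Q) {z : ℂ} (hz : psi z = P) :
    ∃ Γ : C(unitInterval, ℂ), Γ 0 = z ∧ ∀ s, psi (Γ s) = γ s := by
  let γ' : C(unitInterval, Torus) := (psiHomeomorph.symm : C(Curve, Torus)).comp γ.toContinuousMap
  have h0 : γ' 0 = (z : Torus) := by
    change psiHomeomorph.symm (γ 0) = z
    rw [γ.source, Homeomorph.symm_apply_eq]
    exact hz.symm
  refine ⟨isCoveringMap_torus_mk.liftPath γ' z h0, isCoveringMap_torus_mk.liftPath_zero γ' z h0,
    fun s ↦ ?_⟩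
  have h1 : ((isCoveringMap_torus_mk.liftPath γ' z h0 s : ℂ) : Torus) = γ' s :=
    congrFun (isCoveringMap_torus_mk.liftPath_lifts γ' z h0) s
  rw [← psiTorus_coe, h1]
  exact psiHomeomorph.apply_symm_apply (γ s)

end QuarticCurve

/-! ### Path integrals and existence of admissible paths -/

namespace QuarticCurve

open Complex MeasureTheory

/-- A lift of a path is a primitive of the normalized integrand. -/
theorem hasDerivAt_lift {P Q : Curve} {γ : Path P Q} {Γ : ℝ → ℂ} {s : ℝ} (hΓ : ContinuousAt Γ s)
    (hlift : ∀ᶠ r in 𝓝 s, psi (Γ r) = γ.extend r) (hinf : γ.extend s ≠ pointInfty)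
    (h0 : t (γ.extend s) ≠ 0) (h1 : t (γ.extend s) ≠ 1)
    (hd : DifferentiableAt ℝ (fun r : ℝ ↦ t (γ.extend r)) s) :
    HasDerivAt Γ (integrand γ s / normConst) s := by
  have hs := hlift.self_of_nhds
  have hp : Γ s ∉ poles := by
    rw [← psi_eq_infty_iff, hs]
    exact hinf
  have hts : t (γ.extend s) = W (Γ s) ^ 2 + 1 := by rw [← hs, t_psi hp]
  have hus : u (γ.extend s) = U (Γ s) := by rw [← hs, u_psi hp]
  rw [hts] at h0 h1
  have hW : W (Γ s) ≠ 0 := fun h ↦ h1 (by simp [h])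
  have hUsq : U (Γ s) ^ 2 = W (Γ s) * (W (Γ s) ^ 2 + 1) := by
    rw [U_sq hp]
    ring
  have hU : U (Γ s) ≠ 0 := fun h ↦ by
    rw [h, zero_pow two_ne_zero, eq_comm, mul_eq_zero] at hUsq
    exact hUsq.elim hW h0
  have hK := normConst_ne_zero
  -- Off `t = 0, 1, ∞` the function `t ∘ psi` has nonzero derivative, so near `s` the lift is a
  -- local inverse of it composed with `t ∘ γ`.
  have hstrict : HasStrictDerivAt (fun z ↦ W z ^ 2 + 1) (W (Γ s) * normConst * U (Γ s)) (Γ s) := by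
    have h2 := (analyticOnNhd_W _ hp).hasStrictDerivAt
    rw [(hasDerivAt_W hp).deriv] at h2
    refine ((h2.pow 2).add_const 1).congr_deriv ?_
    simp only [Nat.cast_ofNat, Nat.add_one_sub_one, pow_one]
    ring
  have hne : W (Γ s) * normConst * U (Γ s) ≠ 0 := mul_ne_zero (mul_ne_zero hW hK) hU
  have hinv := (hstrict.to_localInverse hne).hasDerivAt
  rw [← hts] at hinv
  have hcomp := hinv.comp s hd.hasDerivAt
  refine (hcomp.congr_of_eventuallyEq ?_).congr_deriv ?_
  · filter_upwards [hlift, hΓ.eventually (hstrict.eventually_left_inverse hne),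
      hΓ.eventually_mem (isClosed_poles.isOpen_compl.mem_nhds hp)] with r hr hr' hr''
    rw [Function.comp_apply, ← hr, t_psi hr'', hr']
  · rw [integrand, hts, hus, add_sub_cancel_right]
    field_simp
    rw [hUsq]
    ring

/-- The lift is continuous everywhere, so the fundamental theorem of calculus tolerates the finitely
many exceptional parameters. -/
theorem pathIntegral_eq {P Q : Curve} {γ : Path P Q} (hγ : Admissible γ)
    {Γ : C(unitInterval, ℂ)} (hΓ : ∀ s, psi (Γ s) = γ s) : pathIntegral γ = Γ 1 - Γ 0 := by
  obtain ⟨⟨S, hS, hreg⟩, hint⟩ := hγ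
  have hcont : Continuous (Set.IccExtend zero_le_one Γ) := Γ.continuous.Icc_extend'
  have key := MeasureTheory.integral_eq_of_hasDerivAt_off_countable_of_le
    (Set.IccExtend zero_le_one Γ) (fun s ↦ integrand γ s / normConst) zero_le_one hS.countable
    hcont.continuousOn (fun s hs ↦ by
      obtain ⟨h1, h2, h3, h4, -⟩ := hreg s hs
      exact hasDerivAt_lift hcont.continuousAt (.of_forall fun r ↦ hΓ _) h1 h2 h3
        (h4.differentiableAt one_ne_zero)) (hint.div_const _)
  rw [intervalIntegral.integral_div, Set.IccExtend_right, Set.IccExtend_left] at key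
  rw [pathIntegral, ← normConst, one_div_mul_eq_div, key]
  rfl

theorem pathIntegral_coe_eq {z : ℂ} {γ : Path pointOne (psi z)} (hγ : Admissible γ) :
    ((pathIntegral γ : ℂ) : Torus) = z := by
  obtain ⟨Γ, h0, hΓ⟩ := exists_lift γ psi_zero
  rw [pathIntegral_eq hγ hΓ, h0, sub_zero, torus_mk_eq_iff]
  exact sub_mem_of_psi_eq ((hΓ 1).trans γ.target)

theorem finite_setOf_add_self_mem {z : ℂ} (hz : z ≠ 0) :
    {s : ℝ | s ∈ Set.Ioo 0 1 ∧ s * z + s * z ∈ gauss.lattice}.Finite := by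
  have hfin : (Metric.closedBall (0 : ℂ) (2 * ‖z‖) ∩ (gauss.lattice : Set ℂ)).Finite :=
    Metric.finite_isBounded_inter_isClosed ⟨inferInstanceAs (DiscreteTopology gauss.lattice)⟩
      Metric.isBounded_closedBall gauss.isClosed_lattice
  have hinj : Function.Injective fun s : ℝ ↦ (s : ℂ) * z + s * z := by
    intro a b hab
    simp only [← two_mul] at hab
    exact ofReal_injective (mul_right_cancel₀ hz (mul_left_cancel₀ two_ne_zero hab))
  refine (hfin.preimage hinj.injOn).subset ?_
  rintro s ⟨hs, hs'⟩
  refine ⟨?_, hs'⟩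
  rw [mem_closedBall_zero_iff]
  beta_reduce
  rw [← two_mul, norm_mul, norm_mul, norm_real, Real.norm_of_nonneg hs.1.le]
  simp only [RCLike.norm_ofNat]
  nlinarith [norm_nonneg z, hs.2]

theorem exists_admissible (P : Curve) : ∃ γ : Path pointOne P, Admissible γ := by
  -- The path will be the image of the segment from `0` to `z`. For `P = pointOne` the parameter `1`
  -- replaces `0`, since a constant path would stay at `t = 1`.
  obtain ⟨z, hz, rfl⟩ : ∃ z, z ≠ 0 ∧ psi z = P := by
    obtain ⟨z, rfl⟩ := surjective_psi P
    by_cases hz : z = 0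
    · refine ⟨z + 1, by simp [hz], psi_add (mem_gauss.2 ⟨1, 0, by simp⟩)⟩
    · exact ⟨z, hz, rfl⟩
  let γ : Path pointOne (psi z) :=
    { toFun := fun s ↦ psi ((s : ℝ) * z)
      continuous_toFun := continuous_psi.comp (by fun_prop)
      source' := by simp [psi_zero]
      target' := by simp }
  set S := {s : ℝ | s ∈ Set.Ioo 0 1 ∧ s * z + s * z ∈ gauss.lattice} with hS
  have hSfin : S.Finite := finite_setOf_add_self_mem hz
  have hext : ∀ s ∈ Set.Ioo (0 : ℝ) 1, ∀ᶠ r : ℝ in 𝓝 s, psi (r * z) = γ.extend r := by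
    intro s hs
    filter_upwards [Ioo_mem_nhds hs.1 hs.2] with r hr
    rw [Path.extend_apply γ (Set.Ioo_subset_Icc_self hr)]
    rfl
  have hreg : ∀ s ∈ Set.Ioo (0 : ℝ) 1 \ S, (s : ℂ) * z ∉ poles ∧ U (s * z) ≠ 0 := by
    rintro s ⟨hs, hsS⟩
    have hns : (s : ℂ) * z + s * z ∉ gauss.lattice := fun h ↦ hsS ⟨hs, h⟩
    -- Poles and zeros of `U` occur only where `2 (x + om)` is a lattice point; as `2 om` is one,
    -- this means that `2 x` is.
    have hadd : ∀ x : ℂ, x + x ∉ gauss.lattice → (x + om) + (x + om) ∉ gauss.lattice := by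
      intro x hx h
      refine hx ?_
      have := sub_mem h two_mul_om_mem
      rwa [show x + om + (x + om) - (om + om) = x + x by ring] at this
    have hp : (s : ℂ) * z ∉ poles := fun h ↦ hadd _ hns (add_mem h h)
    refine ⟨hp, fun hU ↦ hadd _ hns (add_self_mem_of_derivWeierstrassP_eq_zero hp ?_)⟩
    have h1 := halfValue_ne_zero'
    have h2 := normConst_ne_zero
    rw [U, mul_eq_zero] at hU
    exact hU.resolve_left (by simp [halfValue_ne_zero, h2])
  have hprop : ∀ s ∈ Set.Ioo (0 : ℝ) 1 \ S,
      γ.extend s ≠ pointInfty ∧ t (γ.extend s) ≠ 0 ∧ t (γ.extend s) ≠ 1 ∧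
      ContDiffAt ℝ 1 (fun r : ℝ ↦ t (γ.extend r)) s ∧
      ContDiffAt ℝ 1 (fun r : ℝ ↦ u (γ.extend r)) s := by
    intro s hs
    obtain ⟨hp, hU⟩ := hreg s hs
    have hev := hext s hs.1
    have hUsq : U (s * z) ^ 2 = W (s * z) * (W (s * z) ^ 2 + 1) := by
      rw [U_sq hp]
      ring
    have hne : W (s * z) * (W (s * z) ^ 2 + 1) ≠ 0 := hUsq ▸ pow_ne_zero 2 hU
    have hline : ContDiffAt ℝ 1 (fun r : ℝ ↦ (r : ℂ) * z) s := by
      have : ContDiff ℝ 1 fun r : ℝ ↦ (r : ℂ) * z := ofRealCLM.contDiff.mul contDiff_const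
      exact this.contDiffAt
    have hpev : ∀ᶠ r : ℝ in 𝓝 s, (r : ℂ) * z ∉ poles :=
      hline.continuousAt.eventually_mem (isClosed_poles.isOpen_compl.mem_nhds hp)
    have hWc : ContDiffAt ℝ 1 (fun r : ℝ ↦ W (r * z)) s :=
      ContDiffAt.comp (g := W) s ((analyticOnNhd_W _ hp).contDiffAt.restrict_scalars ℝ) hline
    have hUc : ContDiffAt ℝ 1 (fun r : ℝ ↦ U (r * z)) s :=
      ContDiffAt.comp (g := U) s ((analyticOnNhd_U _ hp).contDiffAt.restrict_scalars ℝ) hline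
    rw [← hev.self_of_nhds, t_psi hp]
    refine ⟨mt psi_eq_infty_iff.1 hp, right_ne_zero_of_mul hne, ?_, ?_, ?_⟩
    · simpa using left_ne_zero_of_mul hne
    · refine ((hWc.pow 2).add contDiffAt_const).congr_of_eventuallyEq
        (?_ : _ =ᶠ[_] fun r : ℝ ↦ W (r * z) ^ 2 + 1)
      filter_upwards [hev, hpev] with r hr hr'
      rw [← hr, t_psi hr']
    · refine hUc.congr_of_eventuallyEq ?_
      filter_upwards [hev, hpev] with r hr hr'
      rw [← hr, u_psi hr']
  refine ⟨γ, ⟨S, hSfin, hprop⟩, ?_⟩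
  -- The lift is linear in `s`, so the integrand is constant off a null set, hence integrable.
  have hval : ∀ s ∈ Set.Ioo (0 : ℝ) 1 \ S, integrand γ s = z * normConst := by
    intro s hs
    obtain ⟨h1, h2, h3, h4, -⟩ := hprop s hs
    have hd : HasDerivAt (fun r : ℝ ↦ (r : ℂ) * z) z s := by
      simpa using (ofRealCLM.hasDerivAt (x := s)).mul_const z
    have := (hasDerivAt_lift hd.continuousAt (hext s hs.1) h1 h2 h3
      (h4.differentiableAt one_ne_zero)).unique hd
    rwa [div_eq_iff normConst_ne_zero] at this
  refine (intervalIntegrable_const (c := z * normConst)).congr_ae ?_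
  rw [Set.uIoc_of_le zero_le_one, EventuallyEq, ae_restrict_iff' measurableSet_Ioc]
  filter_upwards [hSfin.countable.ae_notMem volume, (Set.countable_singleton (1 : ℝ)).ae_notMem
    volume] with s hs hs1 hs2
  exact (hval s ⟨⟨hs2.1, lt_of_le_of_ne hs2.2 hs1⟩, hs⟩).symm

end QuarticCurve

/-! ### Inversion of the Abel-Jacobi map and the multiplication formula -/

namespace QuarticCurve

open Complex

theorem abelJacobi_psi (z : ℂ) : abelJacobi (psi z) = z := by
  have h := exists_admissible (psi z)
  rw [abelJacobi, dif_pos h]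
  exact pathIntegral_coe_eq h.choose_spec

theorem bijective_abelJacobi : Function.Bijective abelJacobi := by
  constructor
  · intro P Q h
    obtain ⟨a, rfl⟩ := surjective_psi P
    obtain ⟨b, rfl⟩ := surjective_psi Q
    rw [abelJacobi_psi, abelJacobi_psi] at h
    rw [← psiTorus_coe, ← psiTorus_coe, h]
  · intro x
    induction x using QuotientAddGroup.induction_on with
    | H z => exact ⟨psi z, abelJacobi_psi z⟩

/-- This reduces every case of the theorem to evaluating `psi` at `(1 + i) z`. -/
theorem symm_mulOneAddI_abelJacobi (hj : Function.Bijective abelJacobi) (z : ℂ) :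
    (Equiv.ofBijective abelJacobi hj).symm (mulOneAddI (abelJacobi (psi z))) =
      psi ((1 + I) * z) := by
  rw [Equiv.symm_apply_eq, Equiv.ofBijective_apply, abelJacobi_psi, abelJacobi_psi]
  rfl

theorem exists_symm_mulOneAddI_eq (hj : Function.Bijective abelJacobi) (P : affineCurve)
    (hP : tA P ≠ 0) : ∃ Q : affineCurve,
      (Equiv.ofBijective abelJacobi hj).symm (mulOneAddI (abelJacobi (P : Curve))) = (Q : Curve) ∧
      tA Q = ((tA P - 2) / tA P) ^ 2 ∧
      uA Q = (1 + I) * (uA P * (2 - tA P) / tA P ^ 2) ∧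
      wA Q = 2 * I * uA P ^ 2 / tA P ^ 2 := by
  obtain ⟨z, hz⟩ := surjective_psi P
  have hp : z ∉ poles := fun h ↦ OnePoint.coe_ne_infty P (hz.symm.trans (psi_of_mem h))
  obtain ⟨P', hP', ht, hu, hw⟩ := exists_psi_eq_coe hp
  obtain rfl : P = P' := OnePoint.coe_injective (hz.symm.trans hP')
  have hp' : (1 + I) * z ∉ poles := by
    rw [mul_mem_poles_iff hp, ← ht]
    exact hP
  obtain ⟨Q, hQ, ht', hu', hw'⟩ := exists_psi_eq_coe hp'
  refine ⟨Q, by rw [← hz, symm_mulOneAddI_abelJacobi, hQ], ?_⟩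
  obtain ⟨h1, h2⟩ := W_mul hp hp'
  have hUsq := U_sq hp
  rw [ht] at hP
  rw [← eq_div_iff hP] at h1
  rw [← eq_div_iff (pow_ne_zero 2 hP)] at h2
  rw [ht', hu', hw', h1, h2, ht, hu, hUsq]
  refine ⟨?_, ?_, ?_⟩
  · rw [div_pow, mul_pow, mul_pow, I_sq]
    field_simp
    ring
  · ring
  · field_simp

theorem symm_mulOneAddI_of_tA_eq_zero (hj : Function.Bijective abelJacobi) (P : affineCurve)
    (hP : tA P = 0) : (Equiv.ofBijective abelJacobi hj).symm
      (mulOneAddI (abelJacobi (P : Curve))) = pointInfty := by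
  obtain ⟨z, hz⟩ := surjective_psi P
  have hp : z ∉ poles := fun h ↦ OnePoint.coe_ne_infty P (hz.symm.trans (psi_of_mem h))
  obtain ⟨P', hP', ht, -⟩ := exists_psi_eq_coe hp
  obtain rfl : P = P' := OnePoint.coe_injective (hz.symm.trans hP')
  rw [← hz, symm_mulOneAddI_abelJacobi]
  exact psi_of_mem ((mul_mem_poles_iff hp).2 (ht ▸ hP))

theorem symm_mulOneAddI_infty (hj : Function.Bijective abelJacobi) :
    (Equiv.ofBijective abelJacobi hj).symm (mulOneAddI (abelJacobi pointInfty)) = pointOne := by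
  have h : psi om = pointInfty := psi_of_mem two_mul_om_mem
  have h1 : (1 + I) * om = 0 + I := by
    simp only [om]
    linear_combination I_sq / 2
  rw [← h, symm_mulOneAddI_abelJacobi, h1, psi_add (mem_gauss.2 ⟨0, 1, by simp⟩), psi_zero]

end QuarticCurve

theorem mainTheorem3 :
    -- the Abel-Jacobi map is well defined
    (∀ P : QuarticCurve.Curve,
      ∃ γ : Path QuarticCurve.pointOne P, QuarticCurve.Admissible γ) ∧
    (∀ (P : QuarticCurve.Curve) (γ : Path QuarticCurve.pointOne P), QuarticCurve.Admissible γ →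
      QuarticCurve.abelJacobi P = (QuarticCurve.pathIntegral γ : QuarticCurve.Torus)) ∧
    -- it has an inverse, and the inverse satisfies the multiplication formula
    ∃ hj : Function.Bijective QuarticCurve.abelJacobi,
      (∀ P : QuarticCurve.affineCurve, QuarticCurve.tA P ≠ 0 →
        ∃ Q : QuarticCurve.affineCurve,
          (Equiv.ofBijective QuarticCurve.abelJacobi hj).symm
            (QuarticCurve.mulOneAddI (QuarticCurve.abelJacobi (P : QuarticCurve.Curve))) =
              (Q : QuarticCurve.Curve) ∧
          QuarticCurve.tA Q = ((QuarticCurve.tA P - 2) / QuarticCurve.tA P) ^ 2 ∧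
          QuarticCurve.uA Q = (1 + Complex.I) *
            (QuarticCurve.uA P * (2 - QuarticCurve.tA P) / QuarticCurve.tA P ^ 2) ∧
          QuarticCurve.wA Q = 2 * Complex.I * QuarticCurve.uA P ^ 2 / QuarticCurve.tA P ^ 2) ∧
      (∀ P : QuarticCurve.affineCurve, QuarticCurve.tA P = 0 →
        (Equiv.ofBijective QuarticCurve.abelJacobi hj).symm
          (QuarticCurve.mulOneAddI (QuarticCurve.abelJacobi (P : QuarticCurve.Curve))) =
            QuarticCurve.pointInfty) ∧
      (Equiv.ofBijective QuarticCurve.abelJacobi hj).symm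
        (QuarticCurve.mulOneAddI (QuarticCurve.abelJacobi QuarticCurve.pointInfty)) =
          QuarticCurve.pointOne := by
  refine ⟨QuarticCurve.exists_admissible, fun P γ hγ ↦ ?_, QuarticCurve.bijective_abelJacobi,
    QuarticCurve.exists_symm_mulOneAddI_eq _, QuarticCurve.symm_mulOneAddI_of_tA_eq_zero _,
    QuarticCurve.symm_mulOneAddI_infty _⟩
  obtain ⟨z, rfl⟩ := QuarticCurve.surjective_psi P
  rw [QuarticCurve.abelJacobi_psi, QuarticCurve.pathIntegral_coe_eq hγ]
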